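/- Let $\Lambda=\mathbb{Z}u+\mathbb{Z}v$ be the triangular lattice ($u,v$ unit vectors at an angle of $60^\circ$). A \emph{lattice edge} is a segment between two points of $\Lambda$ that contains no other point of $\Lambda$. Let $\Omega$ be a simple closed polygon with vertices in $\Lambda$. A triangulation of $\Omega$ is a set of lattice edges lying in $\Omega$ and meeting only in lattice points, including the edges of $\Omega$, whose vertices are all the points of $\Lambda$ in $\Omega$ and whose facets in $\Omega$ are all triangles. A \emph{flip} replaces the common side of two adjacent facets that form a strictly convex quadrilateral by the other diagonal of the quadrilateral. A \emph{flip path} from a triangulation $T$ generates a set of edges $G$ if its final triangulation contains $G$; it is \emph{minimum} if no flip path from $T$ that generates $G$ has fewer flips. A \emph{flip plan} that generates $G$ from $T$ is a finite partially ordered set of flips whose linear extensions are exactly the flip paths from $T$ that generate $G$ and perform exactly the flips in the set, each once; it is \emph{minimum} if all its linear extensions are minimum flip paths. For a lattice edge $e$ write $e=xp+yq$ as a vector from an end point $a$, where $p,q$ are consecutive (anticlockwise) unit vectors of $\Lambda$ and $x,y\ge 0$ are relatively prime. Define the partially ordered set of flips $\pi_e$ recursively. If $e$ has unit length, then $\pi_e=\emptyset$.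 Otherwise let $e_1,e_2$ be the vectors, with nonnegative coordinates in $(p,q)$, that correspond to the two Farey neighbors of the fraction $\min(x,y)/\max(x,y)$ in the first Farey sequence that contains it ($e_1=p$, $e_2=q$ if $x=y=1$), so that $e_1+e_2=e$, and let $e_1$ be the longer one if the lengths differ. The maximum of $\pi_e$ is the flip that inserts $e$ in the parallelogram with vertices $a,\,a+e_1,\,a+e,\,a+e_2$ and removes the other diagonal; its children are (unless $e_1$ has unit length) the maxima of $\pi_{e_1}$ placed at $a$ and of $\pi_{e_1}$ placed at $a+e_2$, and below it $\pi_e$ consists of these two partially ordered sets, merged at common flips. For a finite set $E$ of lattice edges let $\pi_E=\bigcup_{e\in E}\pi_e$, merged at common flips (with the order generated by the orders of the $\pi_e$). \textbf{Theorem (Unique, Minimum Flip Plan for Multiple Edges).} Let $\Omega$ admit an equilateral triangulation $T_0$ (a triangulation all of whose edges have equal length), and let $E$ be a finite set of lattice edges contained in $\Omega$ any two of which meet only in lattice points. Then: 1. for each $e\in E$, $\pi_e$ is the unique minimum flip plan that generates $\{e\}$ from $T_0$; 2. $\pi_E$ is the unique minimum flip plan that generates $E$ from $T_0$; 3. for every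 ordering $e_1,\dots,e_n$ of $E$, the edges can be generated sequentially in this order: there are sequences $l_1,\dots,l_n$ such that $l_i$ is a linear extension of $\pi_{e_i}\setminus(\pi_{e_1}\cup\dots\cup\pi_{e_{i-1}})$ with the induced order, and for all such sequences the concatenation $l_1l_2\cdots l_n$ is a minimum flip path that generates $E$ from $T_0$, such that after $l_1\cdots l_k$ the triangulation contains $e_1,\dots,e_k$, for each $k\le n$. -/

import Mathlib

namespace LatticeFlip

/-! ### The triangular lattice -/

/-- A point (or vector) of the triangular lattice, in coordinates with respect to two unit vectors
`u`, `v` at an angle of 60 degrees: `(a, b)` stands for `a u + b v`. -/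
abbrev Pt := ℤ × ℤ

/-- The squared Euclidean length of the lattice vector `a u + b v`. -/
def sqLen (w : Pt) : ℤ := w.1 ^ 2 + w.1 * w.2 + w.2 ^ 2

/-- The lattice point as a point of the real plane (same coordinates; incidence, convexity and
topology do not depend on the choice of the affine coordinates). -/
def toR (p : Pt) : ℝ × ℝ := ((p.1 : ℝ), (p.2 : ℝ))

/-- Twice the signed area of the triangle `a b c`, in lattice units; positive if and only if
`a, b, c` are in anticlockwise order. -/
def orient (a b c : Pt) : ℤ := (b.1 - a.1) * (c.2 - a.2) - (b.2 - a.2) * (c.1 - a.1)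

/-- An unordered pair of lattice points, regarded as a straight line segment. -/
abbrev Edge := Sym2 Pt

/-- The closed line segment of an edge. -/
def seg (e : Edge) : Set (ℝ × ℝ) := convexHull ℝ (toR '' {p | p ∈ e})

/-- Lattice edges: the difference of the end points has relatively prime coordinates. -/
def IsEdge (e : Edge) : Prop :=
  ∃ a b : Pt, e = s(a, b) ∧ IsCoprime (b.1 - a.1) (b.2 - a.2)

/-- Two edges meet at most at lattice points. -/
def NonCrossing (e e' : Edge) : Prop :=
  ∀ x ∈ seg e ∩ seg e', ∃ p : Pt, toR p = x

/-! ### Polygons and lattice triangulations -/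

/-- A simple closed lattice polygon, given by its cyclic list of vertices. All lattice points on the
boundary are listed as vertices (the angle at a vertex may be straight). -/
structure LatticePolygon where
  n : ℕ
  three_le : 3 ≤ n
  vertex : ZMod n → Pt
  vertex_injective : Function.Injective vertex
  isEdge_side : ∀ i, IsEdge s(vertex i, vertex (i + 1))
  simple : ∀ i j, i ≠ j →
    NonCrossing s(vertex i, vertex (i + 1)) s(vertex j, vertex (j + 1))

/-- The `i`-th side of a polygon. -/
def LatticePolygon.side (Ω : LatticePolygon) (i : ZMod Ω.n) : Edge :=
  s(Ω.vertex i, Ω.vertex (i + 1))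

/-- The boundary curve of a polygon. -/
def LatticePolygon.boundary (Ω : LatticePolygon) : Set (ℝ × ℝ) := ⋃ i, seg (Ω.side i)

/-- The closed region bounded by a polygon: the boundary curve, and the points off the curve whose
connected component in the complement of the curve is bounded. -/
def LatticePolygon.region (Ω : LatticePolygon) : Set (ℝ × ℝ) :=
  Ω.boundary ∪
    {x | x ∉ Ω.boundary ∧ Bornology.IsBounded (connectedComponentIn Ω.boundaryᶜ x)}

/-- The (nondegenerate) triangle `a b c` is a triangular facet of the set of edges `T`: its sides
belong to `T`, and it contains no lattice points besides its vertices. -/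
def IsFacet (T : Set Edge) (a b c : Pt) : Prop :=
  orient a b c ≠ 0 ∧ s(a, b) ∈ T ∧ s(b, c) ∈ T ∧ s(c, a) ∈ T ∧
    ∀ p : Pt, toR p ∈ convexHull ℝ {toR a, toR b, toR c} → p = a ∨ p = b ∨ p = c

/-- `T` is the edge set of a triangulation of `Ω` whose vertices are all the lattice points in `Ω`:
a noncrossing set of lattice edges in `Ω`, including the sides of `Ω`, whose facets in `Ω` are all
triangular. -/
structure IsTriangulation (Ω : LatticePolygon) (T : Set Edge) : Prop where
  isEdge : ∀ e ∈ T, IsEdge e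
  subset_region : ∀ e ∈ T, seg e ⊆ Ω.region
  nonCrossing : ∀ e ∈ T, ∀ e' ∈ T, e ≠ e' → NonCrossing e e'
  side_mem : ∀ i, Ω.side i ∈ T
  exists_facet : ∀ x ∈ Ω.region, ∃ a b c : Pt,
    IsFacet T a b c ∧ x ∈ convexHull ℝ {toR a, toR b, toR c}

/-- Equilateral triangulations: all edges have the same length. -/
def IsEquilateralTriangulation (Ω : LatticePolygon) (T : Set Edge) : Prop :=
  IsTriangulation Ω T ∧
    ∀ a b c d : Pt, s(a, b) ∈ T → s(c, d) ∈ T → sqLen (b - a) = sqLen (d - c)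

/-! ### Flips and flip paths -/

/-- A flip, given by the diagonal that it removes and the diagonal that it inserts (these determine
the quadrilateral). -/
@[ext] structure Flip where
  old : Edge
  new : Edge

/-- The flip `f` can be performed on `T`: for some strictly convex quadrilateral `a b c d`
(in anticlockwise order) composed of two facets of `T` that share the diagonal `a c`, it replaces
this diagonal by `b d`. -/
def CanFlip (T : Set Edge) (f : Flip) : Prop :=
  ∃ a b c d : Pt, f.old = s(a, c) ∧ f.new = s(b, d) ∧
    0 < orient a b c ∧ 0 < orient b c d ∧ 0 < orient c d a ∧ 0 < orient d a b ∧
    IsFacet T a b c ∧ IsFacet T a c d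

/-- The result of a flip. -/
def applyFlip (T : Set Edge) (f : Flip) : Set Edge := (T \ {f.old}) ∪ {f.new}

/-- The result of a sequence of flips. -/
def applyFlips (T : Set Edge) (l : List Flip) : Set Edge := l.foldl applyFlip T

/-- The flips in the list can be performed one after the other, starting from `T`. -/
def IsFlipPath : Set Edge → List Flip → Prop
  | _, [] => True
  | T, f :: l => CanFlip T f ∧ IsFlipPath (applyFlip T f) l

/-- The flip path `l` from `T` generates the set of edges `G`. -/
def Generates (T G : Set Edge) (l : List Flip) : Prop :=
  IsFlipPath T l ∧ G ⊆ applyFlips T l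

/-- `l` has the minimum number of flips among the flip paths from `T` that generate `G`. -/
def IsMinFlipPath (T G : Set Edge) (l : List Flip) : Prop :=
  Generates T G l ∧ ∀ l', Generates T G l' → l.length ≤ l'.length

/-! ### Flip plans -/

/-- A set of flips with a relation; see `FlipPoset.IsPoset` for the order axioms. -/
@[ext] structure FlipPoset where
  flips : Set Flip
  le : Flip → Flip → Prop

/-- The relation is a partial order on the (finite) set of flips, and it relates no other flips. -/
structure FlipPoset.IsPoset (π : FlipPoset) : Prop where
  finite : π.flips.Finite
  mem_of_le : ∀ f g, π.le f g → f ∈ π.flips ∧ g ∈ π.flips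
  refl : ∀ f ∈ π.flips, π.le f f
  trans : ∀ f g h, π.le f g → π.le g h → π.le f h
  antisymm : ∀ f g, π.le f g → π.le g f → f = g

/-- The list `l` contains exactly the flips in `π`, each of them once. -/
def FlipPoset.ContainsExactly (π : FlipPoset) (l : List Flip) : Prop :=
  l.Nodup ∧ ∀ f, f ∈ l ↔ f ∈ π.flips

/-- `l` is a valid linear ordering of `π`: it lists the flips of `π`, and no flip is listed after
a greater one. -/
def FlipPoset.IsLinearOrdering (π : FlipPoset) (l : List Flip) : Prop :=
  π.ContainsExactly l ∧ l.Pairwise fun f g => ¬ π.le g f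

/-- `π` is a flip plan that generates `G` from `T`: the valid linear orderings of `π` are the
same as the flip paths from `T` that generate `G` and contain exactly the flips in `π`. -/
def IsFlipPlan (T G : Set Edge) (π : FlipPoset) : Prop :=
  π.IsPoset ∧ ∀ l, π.IsLinearOrdering l ↔ Generates T G l ∧ π.ContainsExactly l

/-- A flip plan all of whose valid linear orderings are minimum flip paths. -/
def IsMinFlipPlan (T G : Set Edge) (π : FlipPoset) : Prop :=
  IsFlipPlan T G π ∧ ∀ l, π.IsLinearOrdering l → IsMinFlipPath T G l

/-- `π` is the one and only minimum flip plan that generates `G` from `T`. -/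
def IsUniqueMinFlipPlan (T G : Set Edge) (π : FlipPoset) : Prop :=
  IsMinFlipPlan T G π ∧ ∀ π', IsMinFlipPlan T G π' → π' = π

/-- The partial order on `F` generated by a set of arcs (directed from child to parent). -/
def FlipPoset.ofArcs (F : Set Flip) (A : Set (Flip × Flip)) : FlipPoset where
  flips := F
  le f g := f ∈ F ∧ g ∈ F ∧ Relation.ReflTransGen (fun s t => (s, t) ∈ A) f g

/-- The flips of `π` that are not in `D`, with the induced order. -/
def FlipPoset.remove (π : FlipPoset) (D : Set Flip) : FlipPoset where
  flips := π.flips \ D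
  le f g := f ∉ D ∧ g ∉ D ∧ π.le f g

/-! ### Edges at points, and the algorithms -/

/-- The six unit vectors of the triangular lattice, in anticlockwise order. -/
def unitVec : Fin 6 → Pt := ![(1, 0), (0, 1), (-1, 1), (-1, 0), (0, -1), (1, -1)]

/-- An edge `(x, y)` at the lattice point `origin`: the segment from `origin` to
`origin + x u + y w`, where the defining coordinate pair `(u, w)` consists of two consecutive unit
vectors and `x`, `y` are relatively prime. -/
structure PlacedEdge where
  origin : Pt
  sector : Fin 6
  x : ℕ
  y : ℕ
  coprime : Nat.Coprime x y

namespace PlacedEdge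

/-- The lattice vector with coordinates `(i, j)` in the defining coordinate pair of `e`. -/
def coordVec (e : PlacedEdge) (i j : ℕ) : Pt :=
  (i : ℤ) • unitVec e.sector + (j : ℤ) • unitVec (e.sector + 1)

/-- The segment represented by the edge at a point. -/
def toEdge (e : PlacedEdge) : Edge := s(e.origin, e.origin + e.coordVec e.x e.y)

/-- The Farey-flip map at `e`, a fraction being a pair (numerator, denominator). -/
def fareyFlip (e : PlacedEdge) : ℕ × ℕ := if e.x < e.y then (e.x, e.y) else (e.y, e.x)

/-- The inverse of the Farey-flip map that belongs to `e`, with values in lattice vectors. -/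
def fareyInv (e : PlacedEdge) (f : ℕ × ℕ) : Pt :=
  if e.x < e.y then e.coordVec f.1 f.2 else e.coordVec f.2 f.1

end PlacedEdge

/-- The loop of the algorithm Farey Plan: `d` is the current fraction, `lo` and `hi` are the
fractions directly before and after it, and the first argument bounds the number of steps. -/
def fareySteps (f : ℕ × ℕ) : ℕ → ℕ × ℕ → ℕ × ℕ → ℕ × ℕ → List (ℕ × ℕ)
  | 0, _, _, _ => []
  | k + 1, lo, d, hi =>
    d :: if d = f then []
      else if d.1 * f.2 < f.1 * d.2 then fareySteps f k d (d + hi) hi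
      else fareySteps f k lo (lo + d) d

/-- The algorithm Farey Plan: empty for unit edges, and otherwise the sequence of mediants that
starts with `1/1` and leads to the fraction of `e`. (The denominators increase strictly, so the
bound on the number of steps is never active; the placeholder `1/0` above `1/1` is never used.) -/
def fareyPlan (e : PlacedEdge) : List (ℕ × ℕ) :=
  if e.x = 0 ∨ e.y = 0 then []
  else fareySteps e.fareyFlip e.fareyFlip.2 (0, 1) (1, 1) (1, 0)

/-- The flip on the Farey parallelogram, placed at `v`, of the last edge `φ f` of a Farey plan;
`C` is the rest of the plan in reverse order. One boundary edge is `φ g`, where `g` is the preceding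
fraction in the plan (`0/1` if `f = 1/1`), the other one is `φ f - φ g`; the inserted edge is the
diagonal `φ f`. -/
def rootFlip (φ : ℕ × ℕ → Pt) (f : ℕ × ℕ) (C : List (ℕ × ℕ)) (v : Pt) : Flip where
  old := s(v + φ (C.headD (0, 1)), v + (φ f - φ (C.headD (0, 1))))
  new := s(v, v + φ f)

/-- The flips in the output of the algorithm Flip Plan at the point `v`, for a reversed Farey
plan: the root flip, and recursively the flips for the two copies, at `v` and at the other end of
the shorter boundary edge, of the longer boundary edge. Duplicates are consolidated. -/
def planFlips (φ : ℕ × ℕ → Pt) : List (ℕ × ℕ) → Pt → Set Flip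
  | [], _ => ∅
  | f :: C, v => {rootFlip φ f C v} ∪ planFlips φ C v ∪
      planFlips φ C (v + (φ f - φ (C.headD (0, 1))))

/-- The arcs, from child to parent, in the output of the algorithm Flip Plan. -/
def planArcs (φ : ℕ × ℕ → Pt) : List (ℕ × ℕ) → Pt → Set (Flip × Flip)
  | [], _ => ∅
  | [_], _ => ∅
  | f :: g :: C, v =>
    {(rootFlip φ g C v, rootFlip φ f (g :: C) v),
      (rootFlip φ g C (v + (φ f - φ g)), rootFlip φ f (g :: C) v)} ∪
    planArcs φ (g :: C) v ∪ planArcs φ (g :: C) (v + (φ f - φ g))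

/-- The flips in the output of the algorithm Flip Plan on the edge `e`. -/
def flipSet (e : PlacedEdge) : Set Flip := planFlips e.fareyInv (fareyPlan e).reverse e.origin

/-- The arcs in the output of the algorithm Flip Plan on the edge `e`. -/
def arcSet (e : PlacedEdge) : Set (Flip × Flip) :=
  planArcs e.fareyInv (fareyPlan e).reverse e.origin

/-- The output of the algorithm Flip Plan on the edge `e`. -/
def flipPlan (e : PlacedEdge) : FlipPoset := .ofArcs (flipSet e) (arcSet e)

/-- The output of the algorithm Multi Flip Plan: the union of the plans of the individual edges,
merged at common flips. -/
def multiFlipPlan (E : Finset PlacedEdge) : FlipPoset :=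
  .ofArcs (⋃ e ∈ E, flipSet e) (⋃ e ∈ E, arcSet e)

/-- The blocks `l₁, …, lₙ` perform the plans of `e₁, …, eₙ` one after the other: `lᵢ` is a valid
linear ordering of the plan of `eᵢ` without the flips that were performed earlier, which are those
in `D` and those in the plans of `e₁, …, eᵢ₋₁`. -/
def IsSequentialOrdering : Set Flip → List PlacedEdge → List (List Flip) → Prop
  | _, [], [] => True
  | D, e :: es, l :: ls =>
    ((flipPlan e).remove D).IsLinearOrdering l ∧
      IsSequentialOrdering (D ∪ (flipPlan e).flips) es ls
  | _, _, _ => False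

/-- The concatenation of the blocks `l₁, …, lₙ` is a flip path from `T`, and the edges
`e₁, …, eₖ` are all present once the blocks `l₁, …, lₖ` have been performed, for each `k`. -/
def GeneratesSequentially (T : Set Edge) (es : List PlacedEdge) (ls : List (List Flip)) : Prop :=
  IsFlipPath T ls.flatten ∧
    ∀ k ≤ es.length, ∀ e ∈ es.take k, e.toEdge ∈ applyFlips T (ls.take k).flatten

end LatticeFlip

open LatticeFlip

/-! The Farey parallelograms are the parallelograms on acute bases, that is, lattice bases `s`, `t`
with positive inner product. Subtracting the shorter member of an acute basis from the longer one
leaves an acute basis until both have unit length (`Acute.sub_left`), and a vector is the sum of an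
acute basis in at most one way (`Acute.split_unique`). So "is a side of the parallelogram of"
generates a well-founded order `Anc` on edges, a Farey flip is determined by the edge it inserts,
and the plan of a set `G` is the down-set `below G` ordered by `Anc` (`planOf`).

Lower bound (`IsFlipPath.mem_of_anc`): facets have minimal area, so every flip happens in a
parallelogram of minimal area whose sides are present. It inserts either the long diagonal, and is
then a Farey flip, or the short one, which has unit length or lies below the diagonal just removed.
Induction along a path that starts from unit edges shows that every Farey flip below a generated
edge was performed. This bounds the length of a path and also forces the order of the flips.

Feasibility: in an order-respecting list, nothing needed may be removed too early. The geometric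
core is `anc_diag_of_cross`, with the consequence `Anc.cross`: an edge that crosses an edge `g`
below `e` either crosses `e` or lies above `g`. Hence crossing edges below noncrossing edges are
comparable (`Anc.comparable`), a flip that removes a side of the parallelogram of `g` comes after
`g`, and no two flips of the plan remove the same edge. The unit edges needed at the start lie in
`T₀`, because each is a side of a unit triangle whose interior some edge of `G` meets.

Uniqueness: a minimum plan must consist of exactly the flips in `below G`, and a finite partial
order is determined by its linear extensions. The Farey algorithm yields this plan because its
mediants list successive longer sides. Sequential generation works because each individual plan is a
down-set. -/

namespace LatticeFlip

/-! ### Acute bases of the lattice -/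

/-- The determinant of two lattice vectors. -/
def det (s t : Pt) : ℤ := s.1 * t.2 - s.2 * t.1

/-- Twice the Euclidean inner product of two lattice vectors. -/
def ip (s t : Pt) : ℤ := 2 * s.1 * t.1 + s.1 * t.2 + s.2 * t.1 + 2 * s.2 * t.2

/-- Two lattice vectors form a basis of the lattice and enclose an acute angle. -/
def Acute (s t : Pt) : Prop := det s t ^ 2 = 1 ∧ 0 < ip s t

/-- Lagrange's identity in lattice coordinates; the 3 comes from the unit parallelogram having area
√3/2. For a lattice basis it ties the lengths to the angle. -/
theorem gram (s t : Pt) : 4 * (sqLen s * sqLen t) = ip s t ^ 2 + 3 * det s t ^ 2 := by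
  simp only [sqLen, ip, det]; ring

theorem sqLen_nonneg (s : Pt) : 0 ≤ sqLen s := by
  simp only [sqLen]; nlinarith [sq_nonneg (s.1 + s.2), sq_nonneg s.1, sq_nonneg s.2]

theorem sqLen_neg (s : Pt) : sqLen (-s) = sqLen s := by simp [sqLen]

theorem sqLen_sub_comm (s t : Pt) : sqLen (s - t) = sqLen (t - s) := by
  rw [← sqLen_neg, neg_sub]

theorem sqLen_add (s t : Pt) : sqLen (s + t) = sqLen s + sqLen t + ip s t := by
  simp [sqLen, ip]; ring

theorem sqLen_sub (s t : Pt) : sqLen (s - t) = sqLen s + sqLen t - ip s t := by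
  simp [sqLen, ip]; ring

theorem sqLen_pos_of_det {s t : Pt} (h : det s t ^ 2 = 1) : 0 < sqLen s := by
  have := gram s t
  rcases (sqLen_nonneg s).lt_or_eq with h0 | h0
  · exact h0
  · rw [← h0, h] at this; nlinarith [sq_nonneg (ip s t)]

theorem det_sq_comm (s t : Pt) : det s t ^ 2 = det t s ^ 2 := by simp only [det]; ring

theorem ip_comm (s t : Pt) : ip s t = ip t s := by simp only [ip]; ring

namespace Acute

variable {s t : Pt}

theorem symm (h : Acute s t) : Acute t s := ⟨by rw [det_sq_comm, h.1], by rw [ip_comm]; exact h.2⟩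

theorem neg (h : Acute s t) : Acute (-s) (-t) := by
  obtain ⟨h1, h2⟩ := h
  constructor
  · rw [← h1]; simp [det]
  · have : ip (-s) (-t) = ip s t := by simp [ip]
    rwa [this]

theorem pos_left (h : Acute s t) : 0 < sqLen s := sqLen_pos_of_det h.1

theorem pos_right (h : Acute s t) : 0 < sqLen t := h.symm.pos_left

theorem add_right (h : Acute s t) : Acute s (s + t) := by
  have hp := h.pos_left
  obtain ⟨h1, h2⟩ := h
  constructor
  · rw [← h1]; simp only [det, Prod.fst_add, Prod.snd_add]; ring
  · have : ip s (s + t) = 2 * sqLen s + ip s t := by simp [ip, sqLen]; ring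
    rw [this]; positivity

theorem add_left (h : Acute s t) : Acute (s + t) t := by
  rw [add_comm]; exact h.symm.add_right.symm

/-- By `gram`, `ip s t ^ 2 + 3` is divisible by 4. Oddness sharpens the integer inequalities in the
descent below. -/
theorem ip_odd (h : Acute s t) : Odd (ip s t) := by
  have := gram s t
  rw [h.1] at this
  rcases Int.even_or_odd (ip s t) with he | ho
  · obtain ⟨k, hk⟩ := he
    rw [hk] at this
    exfalso
    have : 4 * (sqLen s * sqLen t) = 4 * k ^ 2 + 3 := by rw [this]; ring
    omega
  · exact ho

/-- The descent step. If the angle stopped being acute, oddness would give `ip s t ≤ 2 * sqLen t -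
1`, which with `gram` contradicts `sqLen s ≥ sqLen t + 1`. -/
theorem sub_left (h : Acute s t) (hlt : sqLen t < sqLen s) : Acute (s - t) t := by
  have hg := gram s t
  have ho := h.ip_odd
  have hp := h.pos_right
  obtain ⟨h1, h2⟩ := h
  rw [h1] at hg
  constructor
  · rw [← h1]; simp only [det, Prod.fst_sub, Prod.snd_sub]; ring
  · have e : ip (s - t) t = ip s t - 2 * sqLen t := by simp [ip, sqLen]; ring
    rw [e]
    obtain ⟨k, hk⟩ := ho
    by_contra hcon
    have h3 : ip s t ≤ 2 * sqLen t - 1 := by omega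
    nlinarith

/-- The descent stops only at unit vectors: with common squared length `n`, `gram` reads `4n² = ip²
+ 3`, and `ip ≤ 2n - 1` leaves only `n = 1`. -/
theorem sqLen_eq_one (h : Acute s t) (he : sqLen s = sqLen t) : sqLen s = 1 := by
  have hg := gram s t
  have ho := h.ip_odd
  have hp := h.pos_left
  obtain ⟨h1, h2⟩ := h
  rw [h1, ← he] at hg
  obtain ⟨k, hk⟩ := ho
  have h3 : ip s t < 2 * sqLen s := by nlinarith
  have h4 : ip s t ≤ 2 * sqLen s - 1 := by omega
  nlinarith

theorem lt_add_left (h : Acute s t) : sqLen s < sqLen (s + t) := by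
  rw [sqLen_add]; have := h.pos_right; have := h.2; omega

theorem lt_add_right (h : Acute s t) : sqLen t < sqLen (s + t) := by
  rw [sqLen_add]; have := h.pos_left; have := h.2; omega

theorem one_lt_add (h : Acute s t) : 1 < sqLen (s + t) := by
  have := h.lt_add_left; have := h.pos_left; omega

theorem sub_lt_add (h : Acute s t) : sqLen (s - t) < sqLen (s + t) := by
  rw [sqLen_add, sqLen_sub]; have := h.2; omega

theorem sqLen_sub_eq_one (h : Acute s t) (hs : sqLen s = 1) (ht : sqLen t = 1) :
    sqLen (s - t) = 1 := by
  have hg := gram s t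
  rw [h.1, hs, ht] at hg
  have := h.2
  have : ip s t = 1 := by nlinarith
  rw [sqLen_sub, hs, ht, this]; norm_num

/-- A member of an acute basis is a unit vector or splits into an acute basis. -/
theorem unit_or_split (h : Acute s t) :
    sqLen s = 1 ∨ ∃ s' t', Acute s' t' ∧ s = s' + t' := by
  induction hn : (sqLen t).toNat using Nat.strong_induction_on generalizing t with
  | _ n ih =>
    rcases lt_trichotomy (sqLen t) (sqLen s) with hlt | heq | hlt
    · exact Or.inr ⟨s - t, t, h.sub_left hlt, by abel⟩
    · exact Or.inl (h.sqLen_eq_one heq.symm)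
    · have h' := h.symm.sub_left hlt
      refine ih _ ?_ h'.symm rfl
      have := h'.lt_add_left
      rw [sub_add_cancel] at this
      have := h'.pos_left
      omega

/-- The coordinates of a lattice vector in an acute basis. -/
theorem exists_coords (h : Acute s t) (w : Pt) : ∃ x y : ℤ, w = x • s + y • t := by
  refine ⟨det s t * det w t, det s t * det s w, ?_⟩
  have h1 := h.1
  simp only [det] at *
  ext
  · simp
    linear_combination (-w.1) * h1
  · simp
    linear_combination (-w.2) * h1

theorem ne_zero_left (h : Acute s t) : s ≠ 0 := by
  rintro rfl; simpa [sqLen] using h.pos_left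

/-- A lattice vector splits into an acute basis in at most one way. -/
theorem split_unique (h : Acute s t) {s' t' : Pt} (h' : Acute s' t') (he : s + t = s' + t') :
    (s' = s ∧ t' = t) ∨ (s' = t ∧ t' = s) := by
  obtain ⟨x, y, hs'⟩ := h.exists_coords s'
  have ht' : t' = (1 - x) • s + (1 - y) • t := by
    have : t' = s + t - s' := by rw [he]; abel
    rw [this, hs']; module
  have hd : det s' t' ^ 2 = (x - y) ^ 2 * det s t ^ 2 := by
    rw [ht', hs']; simp [det]; ring
  have hi : ip s' t' = 2 * x * (1 - x) * sqLen s + 2 * y * (1 - y) * sqLen t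
      + (x * (1 - y) + y * (1 - x)) * ip s t := by
    rw [ht', hs']; simp [ip, sqLen]; ring
  rw [h.1, h'.1, mul_one] at hd
  have hp := h'.2
  rw [hi] at hp
  have p1 := h.pos_left
  have p2 := h.pos_right
  have p3 := h.2
  -- The determinant fixes `x - y` up to sign. In the formula for `ip s' t'` the two length terms
  -- are nonpositive, so the mixed coefficient must be positive; this leaves only the trivial
  -- splittings.
  have hxy : x - y = 1 ∨ x - y = -1 := by
    have h0 : (x - y - 1) * (x - y + 1) = 0 := by linarith
    rcases mul_eq_zero.mp h0 with h0 | h0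
    · left; omega
    · right; omega
  have key : ∀ z : ℤ, 0 ≤ z * (z - 1) := fun z => by
    rcases le_or_gt z 0 with hz | hz
    · nlinarith
    · nlinarith
  have kx := mul_nonneg (key x) p1.le
  have ky := mul_nonneg (key y) p2.le
  have hxy1 : x * (1 - y) + y * (1 - x) > 0 := by
    by_contra hcon
    have := mul_nonneg (show 0 ≤ -(x * (1 - y) + y * (1 - x)) by omega) p3.le
    nlinarith
  rcases hxy with hxy | hxy
  · obtain rfl : x = y + 1 := by omega
    have : y = 0 := by nlinarith [key y, key (y + 1)]
    subst this
    left; simp [hs', ht']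
  · obtain rfl : y = x + 1 := by omega
    have : x = 0 := by nlinarith [key x, key (x + 1)]
    subst this
    right; simp [hs', ht']

end Acute

theorem isCoprime_of_det {s t : Pt} (h : det s t ^ 2 = 1) {x y : ℤ}
    (hxy : IsCoprime x y) : IsCoprime (x * s.1 + y * t.1) (x * s.2 + y * t.2) := by
  obtain ⟨u, v, huv⟩ := hxy
  refine ⟨det s t * (u * t.2 - v * s.2), det s t * (v * s.1 - u * t.1), ?_⟩
  simp only [det] at *
  linear_combination huv + (u * x + v * y) * h

theorem isCoprime_coords {s t : Pt} {x y : ℤ}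
    (hc : IsCoprime (x • s + y • t).1 (x • s + y • t).2) : IsCoprime x y := by
  obtain ⟨u, v, huv⟩ := hc
  refine ⟨u * s.1 + v * s.2, u * t.1 + v * t.2, ?_⟩
  simp at huv
  linear_combination huv

/-! ### Sides of Farey parallelograms -/

/-- `g` is a side of the Farey parallelogram of the edge `e`. -/
def SideOf (g e : Edge) : Prop :=
  ∃ a s t : Pt, Acute s t ∧ g = s(a, a + s) ∧ e = s(a, a + (s + t))

/-- `g` is reached from `e` by passing repeatedly to a side of the Farey parallelogram. -/
def Anc (g e : Edge) : Prop := Relation.ReflTransGen SideOf g e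

theorem edge_congr {a b c d : Pt} (h : a = c) (h' : b = d) : s(a, b) = s(c, d) := by rw [h, h']

theorem edge_congr' {a b c d : Pt} (h : a = d) (h' : b = c) : s(a, b) = s(c, d) := by
  rw [h, h', Sym2.eq_swap]

theorem anc_of_eq {g e : Edge} (h : g = e) : Anc g e := h ▸ .refl

theorem Acute.sideOf {s t : Pt} (h : Acute s t) {a b c : Pt} (hb : b = a + s)
    (hc : c = a + (s + t)) : SideOf s(a, b) s(a, c) := ⟨a, s, t, h, by rw [hb], by rw [hc]⟩

/-- The parallelogram read from its opposite corner, with basis `-t`, `-s`. -/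
theorem Acute.sideOf' {s t : Pt} (h : Acute s t) {a b c : Pt} (hb : b = a + s)
    (hc : c = a + (s + t)) : SideOf s(b, c) s(a, c) :=
  ⟨c, -t, -s, h.symm.neg, edge_congr' (by rw [hb, hc]; abel) rfl,
    edge_congr' (by rw [hc]; abel) rfl⟩

/-- The squared length of an edge. -/
def edgeLen : Edge → ℤ := Sym2.lift ⟨fun a b => sqLen (b - a), fun a b => sqLen_sub_comm b a⟩

@[simp] theorem edgeLen_mk (a b : Pt) : edgeLen s(a, b) = sqLen (b - a) := rfl

/-- Makes the order well-founded and antisymmetric, and serves as the measure in the inductions on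
`edgeLen`. -/
theorem SideOf.lt {g e : Edge} (h : SideOf g e) : edgeLen g < edgeLen e := by
  obtain ⟨a, s, t, h, rfl, rfl⟩ := h
  simpa using h.lt_add_left

theorem SideOf.pos {g e : Edge} (h : SideOf g e) : 0 < edgeLen g := by
  obtain ⟨a, s, t, h, rfl, rfl⟩ := h
  simpa using h.pos_left

theorem SideOf.one_lt {g e : Edge} (h : SideOf g e) : 1 < edgeLen e := by
  have := h.lt; have := h.pos; omega

theorem Anc.le {g e : Edge} (h : Anc g e) : edgeLen g ≤ edgeLen e := by
  induction h with
  | refl => rfl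
  | tail _ h ih => exact ih.trans h.lt.le

theorem Anc.eq_or_side {g e : Edge} (h : Anc g e) : g = e ∨ ∃ k, Anc g k ∧ SideOf k e := by
  rcases Relation.ReflTransGen.cases_tail h with h | h
  · exact Or.inl h.symm
  · exact Or.inr h

theorem Anc.eq_of_le {g e : Edge} (h : Anc g e) (hl : edgeLen e ≤ edgeLen g) : g = e := by
  rcases h.eq_or_side with h | ⟨k, hk, hs⟩
  · exact h
  · have := hk.le; have := hs.lt; omega

theorem Anc.antisymm {g e : Edge} (h : Anc g e) (h' : Anc e g) : g = e := h.eq_of_le h'.le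

theorem Anc.trans {g e f : Edge} (h : Anc g e) (h' : Anc e f) : Anc g f :=
  Relation.ReflTransGen.trans h h'

theorem SideOf.anc {g e : Edge} (h : SideOf g e) : Anc g e := Relation.ReflTransGen.single h

theorem SideOf.isEdge {g e : Edge} (h : SideOf g e) : IsEdge g := by
  obtain ⟨a, s, t, h, rfl, rfl⟩ := h
  refine ⟨a, a + s, rfl, ?_⟩
  simpa using isCoprime_of_det h.1 (isCoprime_one_left (x := 0))

theorem Anc.isEdge {g e : Edge} (h : Anc g e) (he : IsEdge e) : IsEdge g := by
  rcases Relation.ReflTransGen.cases_head h with rfl | ⟨k, hk, _⟩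
  · exact he
  · exact hk.isEdge

/-- The parallelogram on a given diagonal is unique. -/
theorem Acute.edge_unique {s t s' t' a a' : Pt} (h : Acute s t) (h' : Acute s' t')
    (he : s(a', a' + (s' + t')) = s(a, a + (s + t))) :
    (a' = a ∧ s' = s ∧ t' = t) ∨ (a' = a ∧ s' = t ∧ t' = s) ∨
      (a' = a + (s + t) ∧ s' = -s ∧ t' = -t) ∨ (a' = a + (s + t) ∧ s' = -t ∧ t' = -s) := by
  rw [Sym2.eq_iff] at he
  rcases he with ⟨rfl, he⟩ | ⟨rfl, he⟩
  · rcases h.split_unique h' (add_left_cancel he).symm with h | h <;> simp [h]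
  · have : -s + -t = s' + t' := by
      have h0 : s + t + (s' + t') = 0 := by
        rw [add_assoc] at he; simpa using he
      rw [← neg_add]; exact neg_eq_of_add_eq_zero_right h0
    rcases h.neg.split_unique h' this with h | h <;> simp [h]

theorem Acute.sideOf_iff {s t a : Pt} (h : Acute s t) (k : Edge) :
    SideOf k s(a, a + (s + t)) ↔ k = s(a, a + s) ∨ k = s(a, a + t) ∨
      k = s(a + s, a + s + t) ∨ k = s(a + t, a + t + s) := by
  constructor
  · rintro ⟨a', s', t', h', rfl, he⟩
    rcases h.edge_unique h' he.symm with ⟨rfl, rfl, rfl⟩ | ⟨rfl, rfl, rfl⟩ | ⟨rfl, rfl, rfl⟩ |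
      ⟨rfl, rfl, rfl⟩
    · simp
    · simp
    · right; right; right
      exact edge_congr' (by abel) (by abel)
    · right; right; left
      exact edge_congr' (by abel) (by abel)
  · rintro (rfl | rfl | rfl | rfl)
    · exact h.sideOf rfl rfl
    · exact h.symm.sideOf rfl (by abel)
    · have := h.sideOf' (a := a) rfl rfl
      rwa [← add_assoc] at *
    · have := h.symm.sideOf' (a := a) rfl rfl
      rwa [add_comm s t, ← add_assoc] at *

/-! ### Crossing edges -/

/-- The two edges cross: the end points of each lie strictly on different sides of the other. -/
def Cross (e e' : Edge) : Prop :=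
  ∃ a b c d : Pt, e = s(a, b) ∧ e' = s(c, d) ∧
    orient a b c * orient a b d < 0 ∧ orient c d a * orient c d b < 0

theorem Cross.symm {e e' : Edge} (h : Cross e e') : Cross e' e := by
  obtain ⟨a, b, c, d, h1, h2, h3, h4⟩ := h
  exact ⟨c, d, a, b, h2, h1, h4, h3⟩

theorem orient_swap (a b c : Pt) : orient b a c = -orient a b c := by
  simp only [orient]; ring

theorem cross_mk {a b c d : Pt} : Cross s(a, b) s(c, d) ↔
    orient a b c * orient a b d < 0 ∧ orient c d a * orient c d b < 0 := by
  constructor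
  · rintro ⟨a', b', c', d', h1, h2, h3, h4⟩
    rw [Sym2.eq_iff] at h1 h2
    rcases h1 with ⟨rfl, rfl⟩ | ⟨rfl, rfl⟩ <;> rcases h2 with ⟨rfl, rfl⟩ | ⟨rfl, rfl⟩
    · exact ⟨h3, h4⟩
    · rw [orient_swap d c, orient_swap d c]; constructor <;> linarith
    · rw [orient_swap b a, orient_swap b a]; constructor <;> linarith
    · rw [orient_swap b a, orient_swap b a, orient_swap d c, orient_swap d c]
      constructor <;> linarith
  · rintro ⟨h3, h4⟩
    exact ⟨a, b, c, d, rfl, rfl, h3, h4⟩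

theorem not_cross_self (e : Edge) : ¬ Cross e e := by
  induction e using Sym2.ind with
  | _ a b => rw [cross_mk]; simp [orient]

/-- The lattice point with coordinates `x`, `y` in the basis `s`, `t` at `o`. -/
def pt (o s t : Pt) (x y : ℤ) : Pt := o + (x • s + y • t)

theorem orient_pt (o s t : Pt) (x₁ y₁ x₂ y₂ x₃ y₃ : ℤ) :
    orient (pt o s t x₁ y₁) (pt o s t x₂ y₂) (pt o s t x₃ y₃) =
      det s t * ((x₂ - x₁) * (y₃ - y₁) - (y₂ - y₁) * (x₃ - x₁)) := by
  simp [orient, pt, det]; ring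

theorem cross_pt {o s t : Pt} (h : det s t ^ 2 = 1) {x₁ y₁ x₂ y₂ x₃ y₃ x₄ y₄ : ℤ} :
    Cross s(pt o s t x₁ y₁, pt o s t x₂ y₂) s(pt o s t x₃ y₃, pt o s t x₄ y₄) ↔
    ((x₂ - x₁) * (y₃ - y₁) - (y₂ - y₁) * (x₃ - x₁)) *
      ((x₂ - x₁) * (y₄ - y₁) - (y₂ - y₁) * (x₄ - x₁)) < 0 ∧
    ((x₄ - x₃) * (y₁ - y₃) - (y₄ - y₃) * (x₁ - x₃)) *
      ((x₄ - x₃) * (y₂ - y₃) - (y₄ - y₃) * (x₂ - x₃)) < 0 := by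
  have key : ∀ A B : ℤ, det s t * A * (det s t * B) = A * B := fun A B => by
    linear_combination (A * B) * h
  rw [cross_mk]
  simp only [orient_pt, key]

theorem Acute.exists_pt {s t : Pt} (h : Acute s t) (o c : Pt) : ∃ x y, c = pt o s t x y := by
  obtain ⟨x, y, hxy⟩ := h.exists_coords (c - o)
  exact ⟨x, y, by rw [pt, ← hxy]; abel⟩

theorem pt_zero (o s t : Pt) : pt o s t 0 0 = o := by simp [pt]
theorem pt_left (o s t : Pt) : pt o s t 1 0 = o + s := by simp [pt]
theorem pt_right (o s t : Pt) : pt o s t 0 1 = o + t := by simp [pt]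
theorem pt_both (o s t : Pt) : pt o s t 1 1 = o + (s + t) := by simp [pt]

/-- The claim of `anc_diag_of_cross`. -/
def DiagClaim (s t : Pt) (p q : ℤ) : Prop :=
  ∀ (o : Pt) (x y : ℤ), y < 0 → 0 < y + q → 0 < q * x - p * y → q * x - p * y < q →
    Anc s(o, o + (s + t)) s(pt o s t x y, pt o s t (x + p) (y + q))

/-- A half-turn exchanging `o` and `o + s` carries the parallelogram above the crossed side to the
one below it. -/
theorem DiagClaim.below {s t : Pt} {p q : ℤ} (h : DiagClaim (-s) (-t) p q) (o : Pt) (x y : ℤ)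
    (h1 : y < 0) (h2 : 0 < y + q) (h3 : 0 < q * x - p * y) (h4 : q * x - p * y < q) :
    Anc s(o - t, o + s) s(pt o s t x y, pt o s t (x + p) (y + q)) := by
  have := h (o + s) (1 - (x + p)) (-(y + q)) (by omega) (by omega) (by linarith) (by linarith)
  exact (anc_of_eq (edge_congr' (by abel) rfl)).trans (this.trans
    (anc_of_eq (edge_congr' (by simp only [pt]; module) (by simp only [pt]; module))))

theorem DiagClaim.swap {s t : Pt} {p q : ℤ} (h : DiagClaim t s q p) (o : Pt) (x y : ℤ)
    (h1 : x < 0) (h2 : 0 < x + p) (h3 : 0 < p * y - q * x) (h4 : p * y - q * x < p) :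
    Anc s(o, o + (s + t)) s(pt o s t x y, pt o s t (x + p) (y + q)) := by
  have := h o y x h1 h2 h3 h4
  exact (anc_of_eq (edge_congr rfl (by abel))).trans (this.trans
    (anc_of_eq (edge_congr (by simp only [pt]; abel) (by simp only [pt]; abel))))

/-- An edge in the open cone of an acute basis `s`, `t` that crosses a translate of `s` has the
adjacent translate of the diagonal `s + t` below it. -/
theorem anc_diag_of_cross {s t : Pt} (h : Acute s t) {p q : ℤ} (hp : 0 < p) (hq : 0 < q)
    (hpq : IsCoprime p q) : DiagClaim s t p q := by
  induction hn : (p + q).toNat using Nat.strong_induction_on generalizing s t p q with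
  | _ n ih =>
  intro o x y h1 h2 h3 h4
  -- A Euclidean step on the direction `(p, q)`: for `q < p` the edge lies in the cone of `s`, `s +
  -- t`, for `p < q` in that of `s + t`, `t`.
  rcases lt_trichotomy q p with hlt | heq | hlt
  · have key := ih (p - q + q).toNat (by omega) h.add_right (p := p - q) (q := q) (by omega) hq
      (by simpa [← sub_eq_add_neg] using hpq.add_mul_left_left (-1)) rfl o (x - y) y h1 h2 (by linarith)
      (by linarith)
    refine (h.add_right.symm.sideOf rfl (by abel)).anc.trans (key.trans
      (anc_of_eq (edge_congr (by simp only [pt]; module) (by simp only [pt]; module))))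
  · subst heq
    have k1 : 0 < x - y := by by_contra hc; nlinarith
    have k2 : x - y < 1 := by by_contra hc; nlinarith
    omega
  · have hpq' : IsCoprime p (q - p) := by simpa [← sub_eq_add_neg] using hpq.add_mul_left_right (-1)
    have tr : ∀ x y : ℤ, pt o s t x y = pt o (s + t) t x (y - x) := fun x y => by
      simp only [pt]; module
    have tr' : ∀ x y : ℤ, pt o s t x y = pt (o + s) (s + t) t (x - 1) (y - (x - 1)) :=
      fun x y => by simp only [pt]; module
    have tr'' : ∀ x y : ℤ, pt o s t x y = pt (o - t) (s + t) t x (y + 1 - x) :=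
      fun x y => by simp only [pt]; module
    have I1 := ih (p + (q - p)).toNat (by omega) h.add_left hp (by omega) hpq' rfl
    have I2 := ih (q - p + p).toNat (by omega) h.add_left.symm.neg (by omega) hp hpq'.symm rfl
    have I3 := ih (q - p + p).toNat (by omega) h.add_left.symm (by omega) hp hpq'.symm rfl
    -- The sign tells on which side of the line of the edge the corner `o + s + t` lies. The edge
    -- leaves the triangle `o`, `o + s`, `o + s + t` through the diagonal, at that corner, or
    -- through the side at `o + s`.
    rcases lt_trichotomy (q * x - p * y - q + p) 0 with hl | hl | hl
    · have key := I1 o x (y - x) (by by_contra hc; nlinarith) (by by_contra hc; nlinarith)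
        (by linarith) (by linarith)
      refine (h.add_left.sideOf rfl rfl).anc.trans (key.trans (anc_of_eq ?_))
      rw [tr, tr]; exact edge_congr rfl (congrArg _ (by ring))
    -- The line passes through `o + s + t`, so the edge is followed downwards instead, according to
    -- the position of `o - t`. In every case the edge from `o - t` to `o + s + t` lies below it,
    -- and the wanted diagonal is a side of that edge's parallelogram.
    · rcases lt_trichotomy (q - 2 * p) 0 with hl' | hl' | hl'
      · have key := I3.swap (o - t) x (y + 1 - x) (by by_contra hc; nlinarith)
          (by by_contra hc; nlinarith) (by linarith) (by linarith)
        refine (h.add_left.symm.sideOf' (a := o - t) (b := o) (by abel) (by abel)).anc.trans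
          (Anc.trans (anc_of_eq ?_) (key.trans (anc_of_eq ?_)))
        · exact edge_congr (by abel) (by abel)
        · rw [tr'', tr'']; exact edge_congr rfl (congrArg _ (by ring))
      · obtain rfl : q = 2 * p := by omega
        obtain rfl : p = 1 := by
          have : IsUnit p := hpq.isUnit_of_dvd' dvd_rfl (dvd_mul_left _ _)
          rcases Int.isUnit_iff.mp this with h | h <;> omega
        obtain rfl : y = -1 := by omega
        obtain rfl : x = 0 := by omega
        refine (h.add_left.symm.sideOf' (a := o - t) (b := o) (by abel) (by abel)).anc.trans
          (anc_of_eq (edge_congr (by simp only [pt]; module) (by simp only [pt]; module)))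
      · have key := I1 (o - t) x (y + 1 - x) (by by_contra hc; nlinarith)
          (by by_contra hc; nlinarith) (by linarith) (by linarith)
        refine (h.add_left.symm.sideOf' (a := o - t) (b := o) (by abel) (by abel)).anc.trans
          (Anc.trans (anc_of_eq ?_) (key.trans (anc_of_eq ?_)))
        · exact edge_congr (by abel) (by abel)
        · rw [tr'', tr'']; exact edge_congr rfl (congrArg _ (by ring))
    · have key := I2.below (o + s) (y - (x - 1)) (x - 1) (by by_contra hc; nlinarith)
          (by by_contra hc; nlinarith) (by linarith) (by linarith)
      refine (h.add_left.symm.sideOf' (a := o - t) (b := o) (by abel) (by abel)).anc.trans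
          (Anc.trans (anc_of_eq ?_) (key.trans (anc_of_eq ?_)))
      · exact edge_congr (by abel) (by abel)
      · exact edge_congr (by simp only [pt]; module) (by simp only [pt]; module)

/-- An edge that crosses a side of a Farey parallelogram crosses the diagonal, or is derived from
the diagonal. -/
theorem SideOf.cross {g e g' : Edge} (h : SideOf g e) (hg : IsEdge g') (hc : Cross g' g) :
    Cross g' e ∨ Anc e g' := by
  obtain ⟨a, s, t, h, rfl, rfl⟩ := h
  obtain ⟨c, d, rfl, hcop⟩ := hg
  obtain ⟨x, y, rfl⟩ := h.exists_pt a c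
  obtain ⟨x', y', rfl⟩ := h.exists_pt a d
  have main : ∀ x y x' y' : ℤ, IsCoprime ((pt a s t x' y').1 - (pt a s t x y).1)
      ((pt a s t x' y').2 - (pt a s t x y).2) →
      Cross s(pt a s t x y, pt a s t x' y') s(a, a + s) → y < y' →
      Cross s(pt a s t x y, pt a s t x' y') s(a, a + (s + t)) ∨
      Anc s(a, a + (s + t)) s(pt a s t x y, pt a s t x' y') := by
    intro x y x' y' hcop hc hy
    obtain ⟨p, rfl⟩ : ∃ p, x' = x + p := ⟨x' - x, by ring⟩
    obtain ⟨q, rfl⟩ : ∃ q, y' = y + q := ⟨y' - y, by ring⟩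
    have hq : 0 < q := by omega
    have hcop' : IsCoprime p q := by
      apply isCoprime_coords (s := s) (t := t)
      convert hcop using 1 <;> simp [pt] <;> ring
    rw [or_iff_not_imp_left]
    intro hn
    rw [← pt_left a s t, ← pt_both a s t] at *
    nth_rewrite 3 [← pt_zero a s t] at hc
    nth_rewrite 3 [← pt_zero a s t] at hn
    rw [cross_pt h.1] at hc hn
    obtain ⟨hc1, hc2⟩ := hc
    simp only [sub_zero, zero_mul, one_mul, add_sub_cancel_left, zero_sub] at hc1 hc2 hn
    have y1 : y < 0 := by
      by_contra hcon; nlinarith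
    have y2 : 0 < y + q := by
      by_contra hcon; nlinarith
    have l1 : 0 < q * x - p * y := by
      by_contra hcon; nlinarith
    have l2 : q * x - p * y < q := by
      by_contra hcon; nlinarith
    -- Otherwise the line would separate `o` from `o + s + t` and the edge would cross the diagonal.
    -- Together with `l2` this gives `0 < p`, so the edge points into the open cone.
    have hp : q ≤ p + (q * x - p * y) := by
      by_contra hcon
      apply hn
      have hx : y < x := by
        by_contra h0; nlinarith
      have hx' : x + p < y + q := by
        by_contra h0; nlinarith
      constructor
      · apply mul_neg_of_pos_of_neg <;> nlinarith
      · apply mul_neg_of_neg_of_pos <;> nlinarith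
    have := anc_diag_of_cross h (by omega) hq hcop' a x y y1 y2 l1 l2
    rw [pt_both]
    exact this
  rcases lt_trichotomy y y' with hy | rfl | hy
  · exact main x y x' y' hcop hc hy
  · exfalso
    rw [← pt_left a s t] at hc
    nth_rewrite 3 [← pt_zero a s t] at hc
    rw [cross_pt h.1] at hc
    obtain ⟨-, hc⟩ := hc
    simp at hc
    nlinarith [mul_self_nonneg ((x' - x) * y)]
  · rw [Sym2.eq_swap] at hc ⊢
    refine main x' y' x y ?_ hc hy
    rw [← neg_sub, ← neg_sub (pt a s t x' y').2]
    exact hcop.neg_neg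

theorem not_cross_of_left (a b c : Pt) : ¬ Cross s(a, b) s(a, c) := by
  rw [cross_mk]; simp [orient]

theorem not_cross_of_right (a b c : Pt) : ¬ Cross s(b, a) s(c, a) := by
  rw [Sym2.eq_swap, Sym2.eq_swap (a := c)]; exact not_cross_of_left a b c

theorem SideOf.not_cross {g e : Edge} (h : SideOf g e) : ¬ Cross e g := by
  obtain ⟨a, s, t, h, rfl, rfl⟩ := h
  exact not_cross_of_left _ _ _

theorem SideOf.not_cross_side {k k' e : Edge} (h : SideOf k e) (h' : SideOf k' e) :
    ¬ Cross k k' := by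
  obtain ⟨a, s, t, h, rfl, rfl⟩ := h
  have hpar : ∀ a s t : Pt, ¬ Cross s(a, a + s) s(a + t, a + t + s) := by
    intro a s t
    rw [cross_mk]
    rintro ⟨h1, -⟩
    have : orient a (a + s) (a + t + s) = orient a (a + s) (a + t) := by
      simp [orient]; ring
    rw [this] at h1
    exact absurd h1 (not_lt.mpr (mul_self_nonneg _))
  rcases (h.sideOf_iff k').mp h' with rfl | rfl | rfl | rfl
  · exact not_cross_self _
  · exact not_cross_of_left _ _ _
  · rw [Sym2.eq_swap]; exact not_cross_of_left _ _ _
  · exact hpar a s t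

/-- An edge that crosses an edge below `e` crosses `e`, or lies above that edge. -/
theorem Anc.cross {g e g' : Edge} (h : Anc g e) (hg : IsEdge g') (hc : Cross g' g) :
    Cross g' e ∨ Anc g g' := by
  induction h with
  | refl => exact Or.inl hc
  | tail h hs ih =>
    rcases ih with ih | ih
    · rcases hs.cross hg ih with h1 | h1
      · exact Or.inl h1
      · exact Or.inr ((h.tail hs).trans h1)
    · exact Or.inr ih

/-- `Anc.cross` is applied twice, lifting the crossing first from `g` to `e` and then from `g'` to
`e'`; reaching both would contradict `hn`. -/
theorem Anc.comparable_or {g g' e e' : Edge} (h : Anc g e) (h' : Anc g' e') (he : IsEdge e)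
    (he' : IsEdge e') (hn : ¬ Cross e e') (hc : Cross g g') : Anc g g' ∨ Anc g' e := by
  rcases h.cross (h'.isEdge he') hc.symm with h1 | h1
  · rcases h'.cross he h1.symm with h2 | h2
    · exact absurd h2 hn
    · exact Or.inr h2
  · exact Or.inl h1

/-- Two sides of one parallelogram do not cross, so `comparable_or` applies to them: either it
settles the matter or both edges lie below one shorter side. -/
theorem Anc.comparable_self {g g' e : Edge} (h : Anc g e) (h' : Anc g' e) (he : IsEdge e)
    (hc : Cross g g') : Anc g g' ∨ Anc g' g := by
  induction hn : (edgeLen e).toNat using Nat.strong_induction_on generalizing e with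
  | _ n ih =>
  rcases h.eq_or_side with rfl | ⟨k, hk, hs⟩
  · exact Or.inr h'
  rcases h'.eq_or_side with rfl | ⟨k', hk', hs'⟩
  · exact Or.inl h
  rcases hk.comparable_or hk' hs.isEdge hs'.isEdge (hs.not_cross_side hs') hc with h1 | h1
  · exact Or.inl h1
  · exact ih _ (by have := hs.lt; have := hs.pos; omega) hk h1 hs.isEdge rfl

/-- Crossing edges below noncrossing edges are comparable. -/
theorem Anc.comparable {g g' e e' : Edge} (h : Anc g e) (h' : Anc g' e') (he : IsEdge e)
    (he' : IsEdge e') (hn : ¬ Cross e e') (hc : Cross g g') : Anc g g' ∨ Anc g' g := by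
  rcases h.comparable_or h' he he' hn hc with h1 | h1
  · exact Or.inl h1
  · exact h.comparable_self h1 he hc

/-! ### Farey flips -/

/-- The flips that insert the long diagonal of a Farey parallelogram. -/
def IsFarey (f : Flip) : Prop :=
  ∃ a s t : Pt, Acute s t ∧ f = ⟨s(a + s, a + t), s(a, a + (s + t))⟩

theorem IsFarey.ext {f g : Flip} (hf : IsFarey f) (hg : IsFarey g) (h : f.new = g.new) :
    f = g := by
  obtain ⟨a, s, t, ha, rfl⟩ := hf
  obtain ⟨a', s', t', ha', rfl⟩ := hg
  ext1
  · rcases ha.edge_unique ha' h.symm with ⟨rfl, rfl, rfl⟩ | ⟨rfl, rfl, rfl⟩ | ⟨rfl, rfl, rfl⟩ |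
      ⟨rfl, rfl, rfl⟩
    · rfl
    · exact Sym2.eq_swap
    · exact edge_congr' (by abel) (by abel)
    · exact edge_congr (by abel) (by abel)
  · exact h

theorem IsFarey.cross {f : Flip} (hf : IsFarey f) : Cross f.new f.old := by
  obtain ⟨a, s, t, h, rfl⟩ := hf
  have := (cross_pt (o := a) h.1 (x₁ := 0) (y₁ := 0) (x₂ := 1) (y₂ := 1) (x₃ := 1) (y₃ := 0)
    (x₄ := 0) (y₄ := 1)).mpr (by norm_num)
  rwa [pt_zero, pt_left, pt_right, pt_both] at this

theorem IsFarey.old_lt {f : Flip} (hf : IsFarey f) : edgeLen f.old < edgeLen f.new := by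
  obtain ⟨a, s, t, h, rfl⟩ := hf
  have := h.sub_lt_add
  rw [sqLen_sub_comm] at this
  simpa using this

theorem IsFarey.one_lt {f : Flip} (hf : IsFarey f) : 1 < edgeLen f.new := by
  obtain ⟨a, s, t, h, rfl⟩ := hf
  simpa using h.one_lt_add

theorem IsFarey.not_cross_old {f : Flip} (hf : IsFarey f) {k : Edge} (hk : SideOf k f.new) :
    ¬ Cross f.old k := by
  obtain ⟨a, s, t, h, rfl⟩ := hf
  rcases (h.sideOf_iff k).mp hk with rfl | rfl | rfl | rfl
  · rw [Sym2.eq_swap (a := a) (b := a + s)]; exact not_cross_of_left _ _ _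
  · exact not_cross_of_right _ _ _
  · exact not_cross_of_left _ _ _
  · rw [Sym2.eq_swap (a := a + s)]; exact not_cross_of_left _ _ _

/-- The short diagonal is a side of the parallelogram of a longer side, if there is one. -/
theorem Acute.old_sideOf {s t : Pt} (h : Acute s t) (hlt : sqLen t < sqLen s) (a : Pt) :
    SideOf s(a + s, a + t) s(a, a + s) := by
  rw [Sym2.eq_swap (a := a + s)]
  exact (h.sub_left hlt).symm.sideOf' rfl (by abel)

/-- If `t` is the shorter side then `s = (s - t) + t`, so the removed diagonal, a translate of `±(s
- t)`, is a side of the parallelogram of the longer side. Only the unit rhombus has no longer side.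
-/
theorem IsFarey.old_anc_or {f : Flip} (hf : IsFarey f) :
    Anc f.old f.new ∨ ∃ a s t : Pt, Acute s t ∧ sqLen s = 1 ∧ sqLen t = 1 ∧
      f = ⟨s(a + s, a + t), s(a, a + (s + t))⟩ := by
  obtain ⟨a, s, t, h, rfl⟩ := hf
  rcases lt_trichotomy (sqLen t) (sqLen s) with hlt | heq | hlt
  · exact Or.inl (.tail (h.old_sideOf hlt a).anc (h.sideOf rfl rfl))
  · have := h.sqLen_eq_one heq.symm
    exact Or.inr ⟨a, s, t, h, this, heq.trans this, rfl⟩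
  · left
    have := h.symm.old_sideOf hlt a
    rw [Sym2.eq_swap] at this
    exact .tail this.anc (h.symm.sideOf rfl (by abel))

theorem IsFarey.old_anc {f : Flip} (hf : IsFarey f) :
    edgeLen f.old = 1 ∨ Anc f.old f.new := by
  rcases hf.old_anc_or with h | ⟨a, s, t, h, hs, ht, rfl⟩
  · exact Or.inr h
  · left
    have := h.sqLen_sub_eq_one hs ht
    rw [sqLen_sub_comm] at this
    simpa using this

theorem SideOf.unit_or_flip {g e : Edge} (h : SideOf g e) :
    edgeLen g = 1 ∨ ∃ f, IsFarey f ∧ f.new = g := by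
  obtain ⟨a, s, t, h, rfl, rfl⟩ := h
  rcases h.unit_or_split with h1 | ⟨s', t', h', rfl⟩
  · left; simpa using h1
  · exact Or.inr ⟨_, ⟨a, s', t', h', rfl⟩, rfl⟩

/-- `g` is a longer side of the Farey parallelogram of `e`. -/
def LongSideOf (g e : Edge) : Prop :=
  ∃ a s t : Pt, Acute s t ∧ sqLen t < sqLen s ∧ g = s(a, a + s) ∧ e = s(a, a + (s + t))

theorem LongSideOf.sideOf {g e : Edge} (h : LongSideOf g e) : SideOf g e := by
  obtain ⟨a, s, t, h, -, h1, h2⟩ := h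
  exact ⟨a, s, t, h, h1, h2⟩

theorem SideOf.long_or_unit {g e : Edge} (h : SideOf g e) :
    (∃ k, LongSideOf k e ∧ Anc g k) ∨
      ∃ a s t : Pt, Acute s t ∧ sqLen s = 1 ∧ sqLen t = 1 ∧ g = s(a, a + s) ∧
        e = s(a, a + (s + t)) := by
  obtain ⟨a, s, t, h, rfl, rfl⟩ := h
  rcases lt_trichotomy (sqLen t) (sqLen s) with hlt | heq | hlt
  · exact Or.inl ⟨_, ⟨a, s, t, h, hlt, rfl, rfl⟩, .refl⟩
  · have := h.sqLen_eq_one heq.symm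
    exact Or.inr ⟨a, s, t, h, this, heq.trans this, rfl, rfl⟩
  · refine Or.inl ⟨s(a, a + t), ⟨a, t, s, h.symm, hlt, rfl, by rw [add_comm t]⟩, ?_⟩
    exact ((h.symm.sub_left hlt).symm.sideOf rfl (by abel)).anc

/-- Every edge properly below `e` is below a longer side of `e`, or a side of a unit rhombus. -/
theorem Anc.eq_or_long {g e : Edge} (h : Anc g e) (hg : edgeLen g ≠ 1) :
    g = e ∨ ∃ k, LongSideOf k e ∧ Anc g k := by
  rcases h.eq_or_side with h | ⟨k, hk, hs⟩
  · exact Or.inl h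
  · rcases hs.long_or_unit with ⟨k', hk', h'⟩ | ⟨a, s, t, -, h1, -, rfl, -⟩
    · exact Or.inr ⟨k', hk', hk.trans h'⟩
    · exfalso
      have h0 := hk.le
      simp only [edgeLen_mk, add_sub_cancel_left, h1] at h0
      rcases Relation.ReflTransGen.cases_head hk with rfl | ⟨m, hm, -⟩
      · simp [h1] at hg
      · have := hm.pos; omega

/-- A unit edge below a longer edge is a side of a unit triangle with another side that crosses
the longer edge. -/
theorem Anc.exists_triangle {g e : Edge} (h : Anc g e) (hg : edgeLen g = 1) (he : IsEdge e)
    (h1 : edgeLen e ≠ 1) : ∃ a s t : Pt, Acute s t ∧ sqLen s = 1 ∧ sqLen t = 1 ∧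
      g = s(a, a + s) ∧ Cross s(a + s, a + t) e := by
  induction hn : (edgeLen e).toNat using Nat.strong_induction_on generalizing e with
  | _ n ih =>
  -- The unit side that crosses `k` also crosses `e`, since the alternative in `SideOf.cross` would
  -- place the longer edge `e` below a unit edge.
  have long : ∀ k, LongSideOf k e → Anc g k → ∃ a s t : Pt, Acute s t ∧ sqLen s = 1 ∧
      sqLen t = 1 ∧ g = s(a, a + s) ∧ Cross s(a + s, a + t) e := by
    intro k hk hgk
    have hk1 : edgeLen k ≠ 1 := by
      obtain ⟨a, s, t, h, hlt, rfl, -⟩ := hk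
      have := h.pos_right
      simp; omega
    obtain ⟨a, s, t, hst, hs, ht, rfl, hc⟩ := ih _ (by
      have := hk.sideOf.lt; have := hk.sideOf.pos; omega) hgk hk.sideOf.isEdge hk1 rfl
    refine ⟨a, s, t, hst, hs, ht, rfl, ?_⟩
    have hu := hst.sqLen_sub_eq_one hs ht
    rw [sqLen_sub_comm] at hu
    have hE : IsEdge s(a + s, a + t) := by
      refine ⟨_, _, rfl, ?_⟩
      have := isCoprime_of_det hst.1 (x := -1) (y := 1) isCoprime_one_right
      convert this using 1 <;> simp <;> ring
    rcases hk.sideOf.cross hE hc with h' | h'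
    · exact h'
    · have h2 := h'.le
      have h3 := hk.sideOf.one_lt
      simp [hu] at h2
      omega
  rcases h.eq_or_side with rfl | ⟨k, hk, hs⟩
  · exact absurd hg h1
  · rcases hs.long_or_unit with ⟨k', hk', h'⟩ | ⟨a, s, t, hst, hs1, ht1, rfl, rfl⟩
    · exact long k' hk' (hk.trans h')
    · obtain rfl := hk.eq_of_le (by simp [hg, hs1])
      exact ⟨a, s, t, hst, hs1, ht1, rfl, (IsFarey.cross ⟨a, s, t, hst, rfl⟩).symm⟩

/-! ### Segments and triangles -/

theorem seg_mk (a b : Pt) : seg s(a, b) = segment ℝ (toR a) (toR b) := by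
  have : {p : Pt | p ∈ s(a, b)} = {a, b} := by ext p; simp
  rw [seg, this, Set.image_pair, convexHull_pair]

theorem hull_le {S : Set (ℝ × ℝ)} {α β γ : ℝ} (h : ∀ p ∈ S, α * p.1 + β * p.2 ≤ γ)
    {x : ℝ × ℝ} (hx : x ∈ convexHull ℝ S) : α * x.1 + β * x.2 ≤ γ := by
  have hconv : Convex ℝ {y : ℝ × ℝ | α * y.1 + β * y.2 ≤ γ} := by
    intro y hy z hz u v hu hv huv
    simp only [Set.mem_ofPred_eq, Prod.fst_add, Prod.snd_add, Prod.smul_fst, Prod.smul_snd,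
      smul_eq_mul] at *
    have h1 := mul_le_mul_of_nonneg_left hy hu
    have h2 := mul_le_mul_of_nonneg_left hz hv
    have : γ = u * γ + v * γ := by rw [← add_mul, huv, one_mul]
    linarith
  exact convexHull_min h hconv hx

theorem mem_hull_triple {a b c : ℝ × ℝ} {u v w : ℝ} (hu : 0 ≤ u) (hv : 0 ≤ v) (hw : 0 ≤ w)
    (h : u + v + w = 1) : u • a + v • b + w • c ∈ convexHull ℝ {a, b, c} := by
  have hc := convex_convexHull ℝ ({a, b, c} : Set (ℝ × ℝ))
  have := hc.sum_mem (t := Finset.univ) (w := ![u, v, w]) (z := ![a, b, c])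
    (by intro i _; fin_cases i <;> simp [hu, hv, hw])
    (by simp [Fin.sum_univ_three, h])
    (by intro i _; fin_cases i <;> exact subset_convexHull ℝ _ (by simp))
  simpa [Fin.sum_univ_three] using this

/-- By Cramer's rule some lattice vector is not an integer combination of `s` and `t`; otherwise all
their coordinates would be divisible by `det s t`, whose square would then divide it. -/
theorem exists_not_dvd {s t : Pt} (h1 : 1 < det s t) :
    ∃ z : Pt, ¬ (det s t ∣ det z t ∧ det s t ∣ det s z) := by
  by_contra hcon
  push Not at hcon
  have e1 := hcon (1, 0)
  have e2 := hcon (0, 1)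
  have f1 : det (1, 0) t = t.2 := by simp [det]
  have f2 : det s (1, 0) = -s.2 := by simp [det]
  have f3 : det (0, 1) t = -t.1 := by simp [det]
  have f4 : det s (0, 1) = s.1 := by simp [det]
  rw [f1, f2, dvd_neg] at e1
  rw [f3, f4, dvd_neg] at e2
  have hd : det s t * det s t ∣ det s t := by
    conv_rhs => rw [det]
    exact dvd_sub (mul_dvd_mul e2.2 e1.1) (mul_dvd_mul e1.2 e2.1)
  have := Int.le_of_dvd (by omega) hd
  nlinarith

theorem IsFacet.swap {T : Set Edge} {a b c : Pt} (h : IsFacet T a b c) : IsFacet T a c b := by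
  obtain ⟨h1, h2, h3, h4, h5⟩ := h
  refine ⟨?_, by rwa [Sym2.eq_swap], by rwa [Sym2.eq_swap], by rwa [Sym2.eq_swap], ?_⟩
  · intro h0; apply h1; simp only [orient] at *; linarith
  · intro p hp
    rw [Set.pair_comm] at hp
    have := h5 p hp
    tauto

/-- Facets have the smallest possible area. -/
theorem IsFacet.orient_sq {T : Set Edge} {a b c : Pt} (h : IsFacet T a b c) :
    orient a b c ^ 2 = 1 := by
  wlog hpos : 0 < orient a b c generalizing b c with H
  · have h0 : orient a c b = -orient a b c := by simp only [orient]; ring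
    have := H h.swap (by have := h.1; omega)
    rw [h0] at this; linarith
  by_contra hcon
  obtain ⟨-, -, -, -, hemp⟩ := h
  have ho : orient a b c = det (b - a) (c - a) := by simp [orient, det]
  set s := b - a with hs
  set t := c - a with ht
  rw [ho] at hpos hcon
  have h1 : 1 < det s t := by
    by_contra h0
    have : det s t = 1 := by omega
    rw [this] at hcon; norm_num at hcon
  obtain ⟨z, hz⟩ := exists_not_dvd h1
  have hn : (0 : ℤ) < det s t := by omega
  obtain ⟨n, hnd⟩ : ∃ n, n = det s t := ⟨_, rfl⟩
  -- A point with barycentric coordinates `(n - x - y)/n`, `x/n`, `y/n` lies in the triangle, but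
  -- the bounds exclude the three vertices.
  have key : ∀ (p : Pt) (x y : ℤ), 0 ≤ x → 0 ≤ y → x + y ≤ n → (x ≠ 0 ∨ y ≠ 0) → x < n → y < n →
      n • (p - a) = x • s + y • t → False := by
    intro p x y hx hy hxy hne hxn hyn hp
    have hnR : (0 : ℝ) < n := by rw [hnd]; exact_mod_cast hn
    have hmem : toR p ∈ convexHull ℝ {toR a, toR b, toR c} := by
      have hm := mem_hull_triple (a := toR a) (b := toR b) (c := toR c)
        (u := ((n - x - y : ℤ) : ℝ) / n) (v := (x : ℝ) / n) (w := (y : ℝ) / n)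
        (div_nonneg (by exact_mod_cast (by omega)) hnR.le)
        (div_nonneg (by exact_mod_cast hx) hnR.le) (div_nonneg (by exact_mod_cast hy) hnR.le)
        (by push_cast; field_simp; ring)
      convert hm using 1
      have p1 : (n : ℝ) * (p.1 - a.1) = x * (b.1 - a.1) + y * (c.1 - a.1) := by
        have := congrArg Prod.fst hp
        simp [hs, ht] at this
        exact_mod_cast this
      have p2 : (n : ℝ) * (p.2 - a.2) = x * (b.2 - a.2) + y * (c.2 - a.2) := by
        have := congrArg Prod.snd hp
        simp [hs, ht] at this
        exact_mod_cast this
      ext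
      · simp [toR]; field_simp; linarith
      · simp [toR]; field_simp; linarith
    have hx' : det s t * x = n * det (p - a) t := by
      have q1 := congrArg Prod.fst hp
      have q2 := congrArg Prod.snd hp
      simp at q1 q2
      simp only [det, Prod.fst_sub, Prod.snd_sub]
      linear_combination -t.2 * q1 + t.1 * q2
    have hy' : det s t * y = n * det s (p - a) := by
      have q1 := congrArg Prod.fst hp
      have q2 := congrArg Prod.snd hp
      simp at q1 q2
      simp only [det, Prod.fst_sub, Prod.snd_sub]
      linear_combination s.2 * q1 - s.1 * q2
    rw [hnd] at hx' hy'
    have hx'' := mul_left_cancel₀ hn.ne' hx'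
    have hy'' := mul_left_cancel₀ hn.ne' hy'
    rcases hemp p hmem with rfl | rfl | rfl
    · simp [det] at hx'' hy''; omega
    · rw [← hs] at hx''; omega
    · rw [← ht] at hy''; omega
  have hzz : n • z = det z t • s + det s z • t := by
    rw [hnd]; ext <;> simp [det] <;> ring
  have ex := Int.emod_add_mul_ediv (det z t) n
  have ey := Int.emod_add_mul_ediv (det s z) n
  have bx := Int.emod_nonneg (det z t) (b := n) (by omega)
  have bX := Int.emod_lt_of_pos (det z t) (b := n) (by omega)
  have dy := Int.emod_nonneg (det s z) (b := n) (by omega)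
  have dY := Int.emod_lt_of_pos (det s z) (b := n) (by omega)
  have hne : det z t % n ≠ 0 ∨ det s z % n ≠ 0 := by
    by_contra h0
    push Not at h0
    exact hz ⟨hnd ▸ Int.dvd_of_emod_eq_zero h0.1, hnd ▸ Int.dvd_of_emod_eq_zero h0.2⟩
  generalize det z t % n = x at *
  generalize det s z % n = y at *
  generalize det z t / n = x' at *
  generalize det s z / n = y' at *
  rw [← ex, ← ey] at hzz
  -- `z` is reduced into the fundamental parallelogram; a residue beyond the diagonal is reflected
  -- in the centre.
  rcases le_or_gt (x + y) n with hle | hgt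
  · refine key (a + (z - x' • s - y' • t)) x y bx dy hle hne bX dY ?_
    rw [add_sub_cancel_left, smul_sub, smul_sub, hzz]; module
  · refine key (a + (s + t - (z - x' • s - y' • t))) (n - x) (n - y) (by omega) (by omega)
      (by omega) (by omega) (by omega) (by omega) ?_
    rw [add_sub_cancel_left, smul_sub, smul_sub, smul_sub, hzz]; module

/-! ### Unit triangles -/

theorem unit_cases {s : Pt} (h : sqLen s = 1) : s = (1, 0) ∨ s = (0, 1) ∨ s = (-1, 1) ∨
    s = (-1, 0) ∨ s = (0, -1) ∨ s = (1, -1) := by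
  obtain ⟨x, y⟩ := s
  simp only [sqLen] at h
  have hx : x ≤ 1 := by nlinarith [sq_nonneg (x + 2 * y)]
  have hx' : -1 ≤ x := by nlinarith [sq_nonneg (x + 2 * y)]
  have hy : y ≤ 1 := by nlinarith [sq_nonneg (2 * x + y)]
  have hy' : -1 ≤ y := by nlinarith [sq_nonneg (2 * x + y)]
  interval_cases x <;> interval_cases y <;> simp_all

/-- The vertices of a unit triangle. -/
def triSet (i j k : ℤ) : Set Pt := {p | (i ≤ p.1 ∧ p.1 ≤ i + 1) ∧ (j ≤ p.2 ∧ p.2 ≤ j + 1) ∧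
  (i + j + k ≤ p.1 + p.2 ∧ p.1 + p.2 ≤ i + j + k + 1)}

/-- Unit triangles are the cells of the three families of lattice lines. The strict bounds on
interior points allow `i`, `j`, `k` to be recovered from a single interior point. -/
theorem Acute.exists_triSet {s t : Pt} (h : Acute s t) (hs : sqLen s = 1) (ht : sqLen t = 1)
    (a : Pt) : ∃ i j k : ℤ, ({a, a + s, a + t} : Set Pt) = triSet i j k ∧
      ∀ u v : ℝ, 0 < u → 0 < v → u + v < 1 →
        (i < a.1 + u * s.1 + v * t.1 ∧ a.1 + u * s.1 + v * t.1 < i + 1) ∧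
        (j < a.2 + u * s.2 + v * t.2 ∧ a.2 + u * s.2 + v * t.2 < j + 1) ∧
        (i + j + k < a.1 + u * s.1 + v * t.1 + (a.2 + u * s.2 + v * t.2) ∧
          a.1 + u * s.1 + v * t.1 + (a.2 + u * s.2 + v * t.2) < i + j + k + 1) := by
  obtain ⟨h1, h2⟩ := h
  obtain ⟨x, y⟩ := a
  have fin : ∀ i j k : ℤ, ({(x, y), (x, y) + s, (x, y) + t} : Set Pt) = triSet i j k →
      (∀ u v : ℝ, 0 < u → 0 < v → u + v < 1 →
        (i < x + u * s.1 + v * t.1 ∧ x + u * s.1 + v * t.1 < i + 1) ∧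
        (j < y + u * s.2 + v * t.2 ∧ y + u * s.2 + v * t.2 < j + 1) ∧
        (i + j + k < x + u * s.1 + v * t.1 + (y + u * s.2 + v * t.2) ∧
          x + u * s.1 + v * t.1 + (y + u * s.2 + v * t.2) < i + j + k + 1)) →
      ∃ i j k : ℤ, ({(x, y), (x, y) + s, (x, y) + t} : Set Pt) = triSet i j k ∧
      ∀ u v : ℝ, 0 < u → 0 < v → u + v < 1 →
        (i < x + u * s.1 + v * t.1 ∧ x + u * s.1 + v * t.1 < i + 1) ∧
        (j < y + u * s.2 + v * t.2 ∧ y + u * s.2 + v * t.2 < j + 1) ∧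
        (i + j + k < x + u * s.1 + v * t.1 + (y + u * s.2 + v * t.2) ∧
          x + u * s.1 + v * t.1 + (y + u * s.2 + v * t.2) < i + j + k + 1) :=
    fun i j k h h' => ⟨i, j, k, h, h'⟩
  have sets : ∀ i j k : ℤ, (∀ p q : ℤ, ((p = x ∧ q = y) ∨ (p = x + s.1 ∧ q = y + s.2) ∨
      (p = x + t.1 ∧ q = y + t.2)) ↔ (i ≤ p ∧ p ≤ i + 1) ∧ (j ≤ q ∧ q ≤ j + 1) ∧
      (i + j + k ≤ p + q ∧ p + q ≤ i + j + k + 1)) →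
      ({(x, y), (x, y) + s, (x, y) + t} : Set Pt) = triSet i j k := by
    intro i j k h
    ext ⟨p, q⟩
    simpa [triSet, Prod.ext_iff] using h p q
  rcases unit_cases hs with rfl | rfl | rfl | rfl | rfl | rfl <;>
  rcases unit_cases ht with rfl | rfl | rfl | rfl | rfl | rfl <;>
  first
  | (exfalso; norm_num [ip] at h2; done)
  | (exfalso; norm_num [det] at h1; done)
  | (refine fin x y 0 (sets _ _ _ (by intro p q; dsimp only; omega)) ?_
     intro u v hu hv huv; push_cast; refine ⟨⟨?_, ?_⟩, ⟨?_, ?_⟩, ?_, ?_⟩ <;> linarith)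
  | (refine fin (x - 1) y 1 (sets _ _ _ (by intro p q; dsimp only; omega)) ?_
     intro u v hu hv huv; push_cast; refine ⟨⟨?_, ?_⟩, ⟨?_, ?_⟩, ?_, ?_⟩ <;> linarith)
  | (refine fin (x - 1) y 0 (sets _ _ _ (by intro p q; dsimp only; omega)) ?_
     intro u v hu hv huv; push_cast; refine ⟨⟨?_, ?_⟩, ⟨?_, ?_⟩, ?_, ?_⟩ <;> linarith)
  | (refine fin (x - 1) (y - 1) 1 (sets _ _ _ (by intro p q; dsimp only; omega)) ?_
     intro u v hu hv huv; push_cast; refine ⟨⟨?_, ?_⟩, ⟨?_, ?_⟩, ?_, ?_⟩ <;> linarith)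
  | (refine fin x (y - 1) 0 (sets _ _ _ (by intro p q; dsimp only; omega)) ?_
     intro u v hu hv huv; push_cast; refine ⟨⟨?_, ?_⟩, ⟨?_, ?_⟩, ?_, ?_⟩ <;> linarith)
  | (refine fin x (y - 1) 1 (sets _ _ _ (by intro p q; dsimp only; omega)) ?_
     intro u v hu hv huv; push_cast; refine ⟨⟨?_, ?_⟩, ⟨?_, ?_⟩, ?_, ?_⟩ <;> linarith)

theorem triSet_hull {i j k : ℤ} {x : ℝ × ℝ} (hx : x ∈ convexHull ℝ (toR '' triSet i j k)) :
    (i ≤ x.1 ∧ x.1 ≤ i + 1) ∧ (j ≤ x.2 ∧ x.2 ≤ j + 1) ∧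
      (i + j + k ≤ x.1 + x.2 ∧ x.1 + x.2 ≤ i + j + k + 1) := by
  have key : ∀ α β γ : ℤ, (∀ p ∈ triSet i j k, α * p.1 + β * p.2 ≤ γ) →
      (α : ℝ) * x.1 + β * x.2 ≤ γ := by
    intro α β γ h
    refine hull_le ?_ hx
    rintro _ ⟨p, hp, rfl⟩
    simp only [toR]
    exact_mod_cast h p hp
  have h1 := key (-1) 0 (-i) (fun p hp => by have := hp.1; omega)
  have h2 := key 1 0 (i + 1) (fun p hp => by have := hp.1; omega)
  have h3 := key 0 (-1) (-j) (fun p hp => by have := hp.2.1; omega)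
  have h4 := key 0 1 (j + 1) (fun p hp => by have := hp.2.1; omega)
  have h5 := key (-1) (-1) (-(i + j + k)) (fun p hp => by have := hp.2.2; omega)
  have h6 := key 1 1 (i + j + k + 1) (fun p hp => by have := hp.2.2; omega)
  push_cast at *
  refine ⟨⟨?_, ?_⟩, ⟨?_, ?_⟩, ?_, ?_⟩ <;> linarith

/-! ### Equilateral triangulations -/

theorem exists_facet_of_triangulation {Ω : LatticePolygon} {T : Set Edge}
    (h : IsTriangulation Ω T) : ∃ a b c, IsFacet T a b c := by
  have h0 : toR (Ω.vertex 0) ∈ Ω.region := by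
    refine h.subset_region _ (h.side_mem 0) ?_
    rw [LatticePolygon.side, seg_mk]
    exact left_mem_segment _ _ _
  obtain ⟨a, b, c, hf, -⟩ := h.exists_facet _ h0
  exact ⟨a, b, c, hf⟩

/-- A facet has determinant `±1` and three sides of equal squared length `n`, so `gram` becomes `4n²
= n² + 3`. -/
theorem IsEquilateralTriangulation.edgeLen_eq {Ω : LatticePolygon} {T : Set Edge}
    (h : IsEquilateralTriangulation Ω T) {e : Edge} (he : e ∈ T) : edgeLen e = 1 := by
  obtain ⟨hT, heq⟩ := h
  obtain ⟨a, b, c, hf⟩ := exists_facet_of_triangulation hT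
  have ho := hf.orient_sq
  obtain ⟨-, h1, h2, h3, -⟩ := hf
  have e1 := heq _ _ _ _ h1 h2
  have e2 := heq _ _ _ _ h1 h3
  have g := gram (b - a) (a - c)
  have hd : det (b - a) (a - c) ^ 2 = 1 := by rw [← ho]; simp [det, orient]; ring
  have ha := sqLen_add (b - a) (a - c)
  have hb : sqLen (b - a + (a - c)) = sqLen (c - b) := by
    rw [← sqLen_neg]; congr 1; abel
  have hp := sqLen_pos_of_det hd
  have : sqLen (b - a) = 1 := by
    rw [hb, ← e1, ← e2] at ha
    rw [hd, ← e2] at g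
    have : ip (b - a) (a - c) = - sqLen (b - a) := by linarith
    rw [this] at g
    nlinarith
  induction e using Sym2.ind with
  | _ p q => rw [edgeLen_mk, ← heq _ _ _ _ h1 he, this]

/-- Every point of the polygon lies in a unit triangle with sides in the triangulation. -/
theorem IsEquilateralTriangulation.exists_triSet {Ω : LatticePolygon} {T : Set Edge}
    (h : IsEquilateralTriangulation Ω T) {x : ℝ × ℝ} (hx : x ∈ Ω.region) : ∃ i j k : ℤ,
      (∀ p ∈ triSet i j k, ∀ q ∈ triSet i j k, p ≠ q → s(p, q) ∈ T) ∧
      (i ≤ x.1 ∧ x.1 ≤ i + 1) ∧ (j ≤ x.2 ∧ x.2 ≤ j + 1) ∧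
      (i + j + k ≤ x.1 + x.2 ∧ x.1 + x.2 ≤ i + j + k + 1) := by
  obtain ⟨a, b, c, hf, hm⟩ := h.1.exists_facet x hx
  have ho := hf.orient_sq
  obtain ⟨-, h1, h2, h3, -⟩ := hf
  have l1 := h.edgeLen_eq h1
  have l2 := h.edgeLen_eq h2
  have l3 := h.edgeLen_eq h3
  rw [edgeLen_mk] at l1 l2 l3
  rw [sqLen_sub_comm] at l3
  have hA : Acute (b - a) (c - a) := by
    refine ⟨by rw [← ho]; simp [det, orient], ?_⟩
    have := sqLen_sub (b - a) (c - a)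
    rw [sub_sub_sub_cancel_right, sqLen_sub_comm, l1, l2, l3] at this
    omega
  obtain ⟨i, j, k, hset, -⟩ := hA.exists_triSet l1 l3 a
  rw [add_sub_cancel, add_sub_cancel] at hset
  refine ⟨i, j, k, ?_, triSet_hull ?_⟩
  · rw [← hset]
    have h1' := h1
    have h2' := h2
    have h3' := h3
    rw [Sym2.eq_swap] at h1' h2' h3'
    rintro p (rfl | rfl | rfl) q (rfl | rfl | rfl) hpq <;> first | assumption | exact absurd rfl hpq
  · rwa [← hset, Set.image_insert_eq, Set.image_pair]

/-- An edge that crosses a side of a unit triangle meets the interior of the triangle. -/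
theorem Acute.exists_interior {a s t : Pt} (h : Acute s t) {e : Edge}
    (hc : Cross s(a + s, a + t) e) : ∃ u v : ℝ, 0 < u ∧ 0 < v ∧ u + v < 1 ∧
      ((a.1 + u * s.1 + v * t.1, a.2 + u * s.2 + v * t.2) : ℝ × ℝ) ∈ seg e := by
  induction e using Sym2.ind with
  | _ c d =>
  obtain ⟨c₁, c₂, rfl⟩ := h.exists_pt a c
  obtain ⟨d₁, d₂, rfl⟩ := h.exists_pt a d
  have main : ∀ c₁ c₂ d₁ d₂ : ℤ,
      Cross s(a + s, a + t) s(pt a s t c₁ c₂, pt a s t d₁ d₂) → 0 < 1 - c₁ - c₂ →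
      ∃ u v : ℝ, 0 < u ∧ 0 < v ∧ u + v < 1 ∧
      ((a.1 + u * s.1 + v * t.1, a.2 + u * s.2 + v * t.2) : ℝ × ℝ) ∈
        seg s(pt a s t c₁ c₂, pt a s t d₁ d₂) := by
    intro c₁ c₂ d₁ d₂ hc hA
    rw [← pt_left a s t, ← pt_right a s t, cross_pt h.1] at hc
    obtain ⟨hc1, hc2⟩ := hc
    have hB : 0 < d₁ + d₂ - 1 := by
      by_contra hcon; nlinarith
    have hP : 0 < (d₁ - c₁) * (1 - c₂) - (d₂ - c₂) * (0 - c₁) := by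
      by_contra hcon; nlinarith
    have hR : 0 < (d₂ - c₂) * (1 - c₁) - (d₁ - c₁) * (0 - c₂) := by
      by_contra hcon; nlinarith
    have hA' : (0 : ℝ) < 1 - c₁ - c₂ := by exact_mod_cast hA
    have hB' : (0 : ℝ) < d₁ + d₂ - 1 := by exact_mod_cast hB
    have hP' : (1 : ℝ) ≤ (d₁ - c₁) * (1 - c₂) - (d₂ - c₂) * (0 - c₁) := by exact_mod_cast hP
    have hR' : (1 : ℝ) ≤ (d₂ - c₂) * (1 - c₁) - (d₁ - c₁) * (0 - c₂) := by exact_mod_cast hR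
    obtain ⟨A, hAd⟩ : ∃ A : ℝ, A = 1 - c₁ - c₂ := ⟨_, rfl⟩
    obtain ⟨p, hp⟩ : ∃ p : ℝ, p = d₁ - c₁ := ⟨_, rfl⟩
    obtain ⟨q, hq⟩ : ∃ q : ℝ, q = d₂ - c₂ := ⟨_, rfl⟩
    -- The edge meets the line of the side at parameter `A / (p + q)`. Shrinking this by the factor
    -- `(K - 1) / K` moves into the triangle; the numerators `hP'`, `hR'` are at least 1, so this
    -- `K` keeps both coordinates positive.
    obtain ⟨K, hK⟩ : ∃ K : ℝ, K = 1 + A * (|p| + |q|) := ⟨_, rfl⟩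
    have hpq : 0 < p + q := by rw [hp, hq]; linarith
    rw [← hAd] at hA'
    have hK1 : 1 ≤ K := by
      rw [hK]; nlinarith [mul_nonneg hA'.le (add_nonneg (abs_nonneg p) (abs_nonneg q))]
    have hp1 := mul_le_mul_of_nonneg_left (le_abs_self p) hA'.le
    have hq1 := mul_le_mul_of_nonneg_left (le_abs_self q) hA'.le
    have hp0 := mul_nonneg hA'.le (abs_nonneg p)
    have hq0 := mul_nonneg hA'.le (abs_nonneg q)
    have hK0 : 0 < K := by linarith
    have hAN : A < p + q := by rw [hAd, hp, hq]; linarith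
    rw [← hp, ← hq] at hP' hR'
    have hτ : A * (K - 1) / ((p + q) * K) * ((p + q) * K) = A * (K - 1) :=
      div_mul_cancel₀ _ (by positivity)
    have hτ0 : 0 ≤ A * (K - 1) / ((p + q) * K) :=
      div_nonneg (mul_nonneg hA'.le (by linarith)) (by positivity)
    have hτ1 : A * (K - 1) / ((p + q) * K) ≤ 1 := by
      rw [div_le_one (by positivity)]; nlinarith
    obtain ⟨τ, hτd⟩ : ∃ τ, τ = A * (K - 1) / ((p + q) * K) := ⟨_, rfl⟩
    rw [← hτd] at hτ hτ0 hτ1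
    have hNK : 0 < (p + q) * K := by positivity
    refine ⟨c₁ + τ * p, c₂ + τ * q, ?_, ?_, ?_, ?_⟩
    · refine pos_of_mul_pos_left (b := (p + q) * K) ?_ hNK.le
      have : (c₁ + τ * p) * ((p + q) * K) = K * (p * (1 - c₂) - q * (0 - c₁)) - A * p := by
        have : (c₁ + τ * p) * ((p + q) * K) = c₁ * ((p + q) * K) + p * (τ * ((p + q) * K)) := by
          ring
        rw [this, hτ, hAd]; ring
      rw [this]; nlinarith
    · refine pos_of_mul_pos_left (b := (p + q) * K) ?_ hNK.le
      have : (c₂ + τ * q) * ((p + q) * K) = K * (q * (1 - c₁) - p * (0 - c₂)) - A * q := by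
        have : (c₂ + τ * q) * ((p + q) * K) = c₂ * ((p + q) * K) + q * (τ * ((p + q) * K)) := by
          ring
        rw [this, hτ, hAd]; ring
      rw [this]; nlinarith
    · have h1 : τ * (p + q) * K = A * (K - 1) := by rw [← hτ]; ring
      have h2 : τ * (p + q) < A := by
        by_contra hcon
        push Not at hcon
        have := mul_le_mul_of_nonneg_right hcon hK0.le
        nlinarith
      rw [hAd] at h2
      nlinarith
    · rw [seg_mk, segment_eq_image']
      refine ⟨τ, ⟨hτ0, hτ1⟩, ?_⟩
      ext
      · simp [toR, pt, hp, hq]; ring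
      · simp [toR, pt, hp, hq]; ring
  rcases lt_or_ge 0 (1 - c₁ - c₂) with hA | hA
  · exact main _ _ _ _ hc hA
  · have h0 := hc
    rw [← pt_left a s t, ← pt_right a s t, cross_pt h.1] at h0
    have : 0 < 1 - d₁ - d₂ := by
      by_contra hcon
      nlinarith [h0.1, mul_nonneg (show 0 ≤ -(1 - c₁ - c₂) by omega)
        (show 0 ≤ -(1 - d₁ - d₂) by omega)]
    rw [Sym2.eq_swap (a := pt a s t c₁ c₂)] at hc ⊢
    exact main _ _ _ _ hc this

/-- The sides of a unit triangle that an edge in the polygon passes through. -/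
theorem IsEquilateralTriangulation.mem_of_cross {Ω : LatticePolygon} {T : Set Edge}
    (h : IsEquilateralTriangulation Ω T) {e : Edge} (he : seg e ⊆ Ω.region) {a s t : Pt}
    (hst : Acute s t) (hs : sqLen s = 1) (ht : sqLen t = 1) (hc : Cross s(a + s, a + t) e) :
    s(a, a + s) ∈ T ∧ s(a + s, a + t) ∈ T := by
  obtain ⟨u, v, hu, hv, huv, hx⟩ := hst.exists_interior hc
  obtain ⟨i, j, k, hset, hint⟩ := hst.exists_triSet hs ht a
  have h1 := hint u v hu hv huv
  obtain ⟨i', j', k', hT, h2⟩ := h.exists_triSet (he hx)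
  -- The interior point lies strictly inside the strips of one cell and weakly inside those of the
  -- other, so the integer indices agree.
  have hi : i = i' := by
    have a1 : (i : ℝ) < i' + 1 := by linarith
    have a2 : (i' : ℝ) < i + 1 := by linarith
    norm_cast at a1 a2; omega
  have hj : j = j' := by
    have a1 : (j : ℝ) < j' + 1 := by linarith
    have a2 : (j' : ℝ) < j + 1 := by linarith
    norm_cast at a1 a2; omega
  have hk : i + j + k = i' + j' + k' := by
    have a1 : (i : ℝ) + j + k < i' + j' + k' + 1 := by linarith
    have a2 : (i' : ℝ) + j' + k' < i + j + k + 1 := by linarith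
    norm_cast at a1 a2; omega
  obtain rfl : k = k' := by omega
  subst hi hj
  rw [← hset] at hT
  refine ⟨hT _ (by simp) _ (by simp) ?_, hT _ (by simp) _ (by simp) ?_⟩
  · simpa using hst.ne_zero_left
  · intro h0
    have := hst.1
    rw [add_left_cancel h0] at this
    simp [det, mul_comm] at this

/-- Unit edges in the polygon belong to the equilateral triangulation. -/
theorem IsEquilateralTriangulation.mem_of_unit {Ω : LatticePolygon} {T : Set Edge}
    (h : IsEquilateralTriangulation Ω T) {e : Edge} (he : seg e ⊆ Ω.region)
    (h1 : edgeLen e = 1) : e ∈ T := by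
  induction e using Sym2.ind with
  | _ c d =>
  have main : ∀ c d : Pt, seg s(c, d) ⊆ Ω.region →
      (d - c = (1, 0) ∨ d - c = (0, 1) ∨ d - c = (-1, 1)) → s(c, d) ∈ T := by
    intro c d he h1
    -- A closed unit triangle that contains the midpoint of a unit edge has both ends of the edge as
    -- vertices.
    have hm : (((c.1 + d.1) / 2, (c.2 + d.2) / 2) : ℝ × ℝ) ∈ seg s(c, d) := by
      rw [seg_mk, segment_eq_image']
      refine ⟨1 / 2, by norm_num, ?_⟩
      ext <;> simp [toR] <;> ring
    obtain ⟨i, j, k, hT, h2⟩ := h.exists_triSet (he hm)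
    obtain ⟨⟨a1, a2⟩, ⟨a3, a4⟩, a5, a6⟩ := h2
    have b1 : (2 * i : ℝ) ≤ c.1 + d.1 := by linarith
    have b2 : (c.1 + d.1 : ℝ) ≤ 2 * (i + 1) := by linarith
    have b3 : (2 * j : ℝ) ≤ c.2 + d.2 := by linarith
    have b4 : (c.2 + d.2 : ℝ) ≤ 2 * (j + 1) := by linarith
    have b5 : (2 * (i + j + k) : ℝ) ≤ c.1 + d.1 + (c.2 + d.2) := by linarith
    have b6 : (c.1 + d.1 + (c.2 + d.2) : ℝ) ≤ 2 * (i + j + k + 1) := by linarith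
    norm_cast at b1 b2 b3 b4 b5 b6
    simp only [Prod.ext_iff, Prod.fst_sub, Prod.snd_sub] at h1
    refine hT c ?_ d ?_ ?_
    · simp only [triSet, Set.mem_ofPred_eq]; omega
    · simp only [triSet, Set.mem_ofPred_eq]; omega
    · rintro rfl; omega
  rw [edgeLen_mk] at h1
  rcases unit_cases h1 with h0 | h0 | h0 | h0 | h0 | h0
  · exact main c d he (by simp [h0])
  · exact main c d he (by simp [h0])
  · exact main c d he (by simp [h0])
  all_goals
    rw [Sym2.eq_swap] at he ⊢
    exact main d c he (by rw [← neg_sub, h0]; simp)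

theorem NonCrossing.not_cross {e e' : Edge} (h : NonCrossing e e') (he : IsEdge e) :
    ¬ Cross e e' := by
  obtain ⟨a, b, rfl, hab⟩ := he
  induction e' using Sym2.ind with
  | _ c d =>
  rw [cross_mk]
  rintro ⟨h1, h2⟩
  obtain ⟨A, hA⟩ : ∃ A, A = orient c d a := ⟨_, rfl⟩
  obtain ⟨B, hB⟩ : ∃ B, B = orient c d b := ⟨_, rfl⟩
  obtain ⟨C, hC⟩ : ∃ C, C = orient a b c := ⟨_, rfl⟩
  obtain ⟨D, hD⟩ : ∃ D, D = orient a b d := ⟨_, rfl⟩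
  rw [← hA, ← hB] at h2
  rw [← hC, ← hD] at h1
  have frac : ∀ x y : ℤ, x * y < 0 → 0 < (x : ℝ) / (x - y) ∧ (x : ℝ) / (x - y) < 1 ∧
      (x : ℝ) - y ≠ 0 := by
    intro x y hxy
    rcases lt_trichotomy x 0 with hx | rfl | hx
    · have hy : 0 < y := by by_contra; nlinarith
      have hx' : (x : ℝ) < 0 := by exact_mod_cast hx
      have hy' : (0 : ℝ) < y := by exact_mod_cast hy
      refine ⟨div_pos_of_neg_of_neg hx' (by linarith), ?_, by linarith⟩
      rw [div_lt_one_of_neg (by linarith)]; linarith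
    · simp at hxy
    · have hy : y < 0 := by by_contra; nlinarith
      have hx' : (0 : ℝ) < x := by exact_mod_cast hx
      have hy' : (y : ℝ) < 0 := by exact_mod_cast hy
      refine ⟨div_pos hx' (by linarith), ?_, by linarith⟩
      rw [div_lt_one (by linarith)]; linarith
  obtain ⟨t0, t1, hne⟩ := frac A B h2
  obtain ⟨u0, u1, hne'⟩ := frac C D h1
  have hABC : (A : ℝ) - B = -((C : ℝ) - D) := by
    rw [hA, hB, hC, hD]; simp only [orient]; push_cast; ring
  set τ : ℝ := A / (A - B) with hτ
  have hτ' : τ * (A - B) = A := div_mul_cancel₀ _ hne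
  have hm1 : toR a + τ • (toR b - toR a) ∈ seg s(a, b) := by
    rw [seg_mk, segment_eq_image']
    exact ⟨τ, ⟨t0.le, t1.le⟩, rfl⟩
  have hm2 : toR a + τ • (toR b - toR a) ∈ seg s(c, d) := by
    rw [seg_mk, segment_eq_image']
    refine ⟨(C : ℝ) / (C - D), ⟨u0.le, u1.le⟩, ?_⟩
    have hu' : (C : ℝ) / (C - D) * (C - D) = C := div_mul_cancel₀ _ hne'
    set u : ℝ := C / (C - D)
    ext
    · simp only [toR, Prod.fst_add, Prod.smul_fst, Prod.fst_sub, smul_eq_mul]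
      apply mul_right_cancel₀ hne'
      have : τ * (C - D) = -A := by rw [← hτ', hABC]; ring
      have e1 : ((c.1 : ℝ) + u * (d.1 - c.1)) * (C - D) = c.1 * (C - D) + C * (d.1 - c.1) := by
        linear_combination (d.1 - c.1 : ℝ) * hu'
      have e2 : ((a.1 : ℝ) + τ * (b.1 - a.1)) * (C - D) = a.1 * (C - D) - A * (b.1 - a.1) := by
        linear_combination (b.1 - a.1 : ℝ) * this
      rw [e1, e2, hA, hC, hD]; simp only [orient]; push_cast; ring
    · simp only [toR, Prod.snd_add, Prod.smul_snd, Prod.snd_sub, smul_eq_mul]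
      apply mul_right_cancel₀ hne'
      have : τ * (C - D) = -A := by rw [← hτ', hABC]; ring
      have e1 : ((c.2 : ℝ) + u * (d.2 - c.2)) * (C - D) = c.2 * (C - D) + C * (d.2 - c.2) := by
        linear_combination (d.2 - c.2 : ℝ) * hu'
      have e2 : ((a.2 : ℝ) + τ * (b.2 - a.2)) * (C - D) = a.2 * (C - D) - A * (b.2 - a.2) := by
        linear_combination (b.2 - a.2 : ℝ) * this
      rw [e1, e2, hA, hC, hD]; simp only [orient]; push_cast; ring
  obtain ⟨p, hp⟩ := h _ ⟨hm1, hm2⟩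
  have p1 : (p.1 : ℝ) - a.1 = τ * (b.1 - a.1) := by
    have := congrArg Prod.fst hp
    simp [toR] at this
    linarith
  have p2 : (p.2 : ℝ) - a.2 = τ * (b.2 - a.2) := by
    have := congrArg Prod.snd hp
    simp [toR] at this
    linarith
  obtain ⟨m, n, hmn⟩ := hab
  have hmn' : (m : ℝ) * (b.1 - a.1) + n * (b.2 - a.2) = 1 := by exact_mod_cast hmn
  -- A lattice point on a primitive edge has an integer parameter by Bézout, but `τ` lies strictly
  -- between 0 and 1.
  have hτZ : ((m * (p.1 - a.1) + n * (p.2 - a.2) : ℤ) : ℝ) = τ := by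
    push_cast
    rw [p1, p2]
    linear_combination τ * hmn'
  rw [← hτZ] at t0 t1
  have i1 : 0 < m * (p.1 - a.1) + n * (p.2 - a.2) := by exact_mod_cast t0
  have i2 : m * (p.1 - a.1) + n * (p.2 - a.2) < 1 := by exact_mod_cast t1
  omega

/-! ### Flip paths -/

theorem applyFlips_append (T : Set Edge) (l l' : List Flip) :
    applyFlips T (l ++ l') = applyFlips (applyFlips T l) l' := List.foldl_append

theorem isFlipPath_append {T : Set Edge} {l l' : List Flip} :
    IsFlipPath T (l ++ l') ↔ IsFlipPath T l ∧ IsFlipPath (applyFlips T l) l' := by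
  induction l generalizing T with
  | nil => simp [IsFlipPath, applyFlips]
  | cons f l ih => simp [IsFlipPath, applyFlips, ih, and_assoc]

theorem mem_applyFlips {T : Set Edge} {l : List Flip} {h : Edge}
    (h1 : h ∈ T ∨ ∃ f ∈ l, f.new = h) (h2 : ∀ f ∈ l, f.old ≠ h) : h ∈ applyFlips T l := by
  induction l generalizing T with
  | nil => simpa [applyFlips] using h1
  | cons f l ih =>
    have hold := h2 f (by simp)
    refine ih (T := applyFlip T f) ?_ fun f' hf' => h2 f' (by simp [hf'])
    rcases h1 with h1 | ⟨f', hf', rfl⟩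
    · exact Or.inl (Or.inl ⟨h1, fun h0 => hold h0.symm⟩)
    · rcases List.mem_cons.mp hf' with rfl | hf'
      · exact Or.inl (Or.inr rfl)
      · exact Or.inr ⟨f', hf', rfl⟩

/-- Flips take place in parallelograms. -/
theorem CanFlip.exists_parallelogram {T : Set Edge} {f : Flip} (h : CanFlip T f) :
    ∃ a s t : Pt, det s t ^ 2 = 1 ∧ f.old = s(a + s, a + t) ∧ f.new = s(a, a + (s + t)) ∧
      f.old ∈ T ∧ s(a, a + s) ∈ T ∧ s(a, a + t) ∈ T ∧ s(a + s, a + s + t) ∈ T ∧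
      s(a + t, a + t + s) ∈ T := by
  obtain ⟨a, b, c, d, h1, h2, p1, p2, p3, p4, f1, f2⟩ := h
  have o1 := f1.orient_sq
  have o2 := f2.orient_sq
  have q1 : orient a b c = 1 := by nlinarith
  have q2 : orient a c d = 1 := by
    have : orient a c d = orient c d a := by simp only [orient]; ring
    have p5 : 0 < orient a c d := this ▸ p3
    nlinarith
  -- Two minimal facets have total area 2, and so do the positive triangles cut off by the other
  -- diagonal. All four are therefore minimal, which forces a parallelogram.
  have hsum : orient b c d + orient d a b = orient a b c + orient a c d := by
    simp only [orient]; ring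
  have q3 : orient b c d = 1 := by omega
  have hd : d = a + c - b := by
    simp only [orient] at q1 q2 q3
    ext
    · simp only [Prod.fst_sub, Prod.fst_add]
      have e1 : (b.1 - a.1) * (d.2 - a.2 - (c.2 - b.2)) - (b.2 - a.2) * (d.1 - a.1 - (c.1 - b.1))
        = 0 := by linarith
      have e2 : (c.1 - b.1) * (d.2 - a.2 - (c.2 - b.2)) - (c.2 - b.2) * (d.1 - a.1 - (c.1 - b.1))
        = 0 := by linarith
      linear_combination (c.1 - b.1) * e1 - (b.1 - a.1) * e2 + (-(d.1 - a.1 - (c.1 - b.1))) * q1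
    · simp only [Prod.snd_sub, Prod.snd_add]
      have e1 : (b.1 - a.1) * (d.2 - a.2 - (c.2 - b.2)) - (b.2 - a.2) * (d.1 - a.1 - (c.1 - b.1))
        = 0 := by linarith
      have e2 : (c.1 - b.1) * (d.2 - a.2 - (c.2 - b.2)) - (c.2 - b.2) * (d.1 - a.1 - (c.1 - b.1))
        = 0 := by linarith
      linear_combination (c.2 - b.2) * e1 - (b.2 - a.2) * e2 + (-(d.2 - a.2 - (c.2 - b.2))) * q1
  obtain ⟨-, t1, t2, t3, -⟩ := f1
  obtain ⟨-, -, t4, t5, -⟩ := f2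
  refine ⟨b, a - b, c - b, ?_, ?_, ?_, ?_, ?_, ?_, ?_, ?_⟩
  · rw [← o1]; simp only [det, orient, Prod.fst_sub, Prod.snd_sub]; ring
  · rw [h1]; exact edge_congr (by abel) (by abel)
  · rw [h2, hd]; exact edge_congr rfl (by abel)
  · rw [h1, Sym2.eq_swap]; exact t3
  · convert t1 using 1; exact edge_congr' rfl (by abel)
  · convert t2 using 1; exact edge_congr rfl (by abel)
  · convert t5 using 1; exact edge_congr' (by abel) (by rw [hd]; abel)
  · convert t4 using 1; exact edge_congr (by abel) (by rw [hd]; abel)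

/-- A flip path that starts with unit edges contains all flips below each edge that it
generates. -/
theorem IsFlipPath.mem_of_anc {T : Set Edge} (hT : ∀ e ∈ T, edgeLen e = 1) {l : List Flip}
    (hl : IsFlipPath T l) {h : Edge} (hh : h ∈ applyFlips T l) {f : Flip} (hf : IsFarey f)
    (ha : Anc f.new h) : f ∈ l := by
  induction l using List.reverseRecOn generalizing h with
  | nil =>
    have h1 := ha.le
    rw [hT h hh] at h1
    have := hf.one_lt
    omega
  | append_singleton l g ih =>
    rw [isFlipPath_append] at hl
    obtain ⟨hl, hg, -⟩ := hl
    have ih' : ∀ {h : Edge}, h ∈ applyFlips T l → Anc f.new h → f ∈ l ++ [g] :=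
      fun hh ha => List.mem_append_left _ (ih hl hh ha)
    rw [applyFlips_append] at hh
    rcases hh with hh | hh
    · exact ih' hh.1 ha
    · obtain rfl : h = g.new := hh
      obtain ⟨a, s, t, hd, ho, hn, m0, m1, m2, m3, m4⟩ := hg.exists_parallelogram
      -- For an obtuse angle the flip inserts the short diagonal and its reverse is a Farey flip, so
      -- the removed edge already required `f`. A right angle is impossible modulo 4. For an acute
      -- angle `f` is the flip itself or lies below one of the sides.
      rcases lt_trichotomy (ip s t) 0 with hi | hi | hi
      · have hA : Acute (-s) t :=
          ⟨by rw [← hd]; simp [det]; ring, by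
            have : ip (-s) t = -ip s t := by simp [ip]; ring
            omega⟩
        have hF : IsFarey ⟨g.new, g.old⟩ :=
          ⟨a + s, -s, t, hA, by
            ext1
            · simp only; rw [hn]; exact edge_congr (by abel) (by abel)
            · simp only; rw [ho]; exact edge_congr rfl (by abel)⟩
        rcases hF.old_anc with h1 | h1
        · simp only at h1
          have := ha.le
          have := hf.one_lt
          omega
        · exact ih' m0 (ha.trans h1)
      · have := gram s t
        rw [hd, hi] at this
        omega
      · have hA : Acute s t := ⟨hd, hi⟩
        rcases ha.eq_or_side with h1 | ⟨k, hk, hs⟩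
        · have : f = g := hf.ext ⟨a, s, t, hA, by ext1 <;> assumption⟩ h1
          simp [this]
        · rw [hn, hA.sideOf_iff] at hs
          rcases hs with rfl | rfl | rfl | rfl
          · exact ih' m1 hk
          · exact ih' m2 hk
          · exact ih' m3 hk
          · exact ih' m4 hk

/-! ### The plan for a set of edges -/

/-- The Farey flips below some edge in `G`. -/
def below (G : Set Edge) : Set Flip := {f | IsFarey f ∧ ∃ e ∈ G, Anc f.new e}

/-- The flips below `G`, ordered by derivation of the inserted edges. -/
def planOf (G : Set Edge) : FlipPoset where
  flips := below G
  le f g := f ∈ below G ∧ g ∈ below G ∧ Anc f.new g.new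

theorem finite_anc (e : Edge) : {g | Anc g e}.Finite := by
  induction hn : (edgeLen e).toNat using Nat.strong_induction_on generalizing e with
  | _ n ih =>
  have hsub : {g | Anc g e} ⊆ {e} ∪ ⋃ k ∈ {k | SideOf k e}, {g | Anc g k} := by
    intro g hg
    rcases Anc.eq_or_side hg with rfl | ⟨k, hk, hs⟩
    · simp
    · right; simp only [Set.mem_iUnion]; exact ⟨k, hs, hk⟩
  refine Set.Finite.subset ((Set.finite_singleton e).union (Set.Finite.biUnion ?_ ?_)) hsub
  · by_cases hne : ∃ k, SideOf k e
    · obtain ⟨k, a, s, t, h, -, rfl⟩ := hne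
      refine Set.Finite.subset (Set.toFinite {s(a, a + s), s(a, a + t), s(a + s, a + s + t),
        s(a + t, a + t + s)}) fun k hk => ?_
      simpa using (h.sideOf_iff k).mp hk
    · push Not at hne
      exact Set.Finite.subset Set.finite_empty fun k hk => hne k hk
  · intro k hk
    have := hk.lt
    have := hk.pos
    exact ih _ (by omega) k rfl

theorem finite_below {G : Set Edge} (hG : G.Finite) : (below G).Finite := by
  have h1 : (⋃ e ∈ G, {g | Anc g e}).Finite := hG.biUnion fun e _ => finite_anc e
  refine Set.Finite.of_finite_image (f := Flip.new) (h1.subset ?_)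
    fun f hf g hg h => hf.1.ext hg.1 h
  rintro _ ⟨f, ⟨-, e, he, h⟩, rfl⟩
  simp only [Set.mem_iUnion]
  exact ⟨e, he, h⟩

theorem isPoset_planOf {G : Set Edge} (hG : G.Finite) : (planOf G).IsPoset where
  finite := finite_below hG
  mem_of_le _ _ h := ⟨h.1, h.2.1⟩
  refl _ h := ⟨h, h, .refl⟩
  trans _ _ _ h h' := ⟨h.1, h'.2.1, h.2.2.trans h'.2.2⟩
  antisymm _ _ h h' := h.1.1.ext h.2.1.1 (h.2.2.antisymm h'.2.2)

theorem below_of_anc {G : Set Edge} {f g : Flip} (hg : g ∈ below G) (hf : IsFarey f)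
    (h : Anc f.new g.new) : f ∈ below G := by
  obtain ⟨-, e, he, h'⟩ := hg
  exact ⟨hf, e, he, h.trans h'⟩

/-- The set of edges `G` can be generated from `T`: its members do not cross, and the necessary
unit edges are present. -/
structure Admissible (T G : Set Edge) : Prop where
  unit : ∀ e ∈ T, edgeLen e = 1
  finite : G.Finite
  isEdge : ∀ e ∈ G, IsEdge e
  not_cross : ∀ e ∈ G, ∀ e' ∈ G, ¬ Cross e e'
  mem_of_unit : ∀ e ∈ G, edgeLen e = 1 → e ∈ T
  exists_flip : ∀ e ∈ G, edgeLen e ≠ 1 → ∃ f, IsFarey f ∧ f.new = e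
  mem_of_cross : ∀ e ∈ G, ∀ a s t : Pt, Acute s t → sqLen s = 1 → sqLen t = 1 →
    Cross s(a + s, a + t) e → s(a, a + s) ∈ T ∧ s(a + s, a + t) ∈ T

theorem Anc.unit_or_flip {g e : Edge} (h : Anc g e) (hne : g ≠ e) :
    edgeLen g = 1 ∨ ∃ f, IsFarey f ∧ f.new = g := by
  rcases Relation.ReflTransGen.cases_head h with h | ⟨k, hk, -⟩
  · exact absurd h hne
  · exact hk.unit_or_flip

theorem IsFarey.isEdge_old {f : Flip} (hf : IsFarey f) : IsEdge f.old := by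
  obtain ⟨a, s, t, h, rfl⟩ := hf
  refine ⟨_, _, rfl, ?_⟩
  have := isCoprime_of_det h.1 (x := -1) (y := 1) isCoprime_one_right
  convert this using 1 <;> simp <;> ring

/-- Distinct edges with the same midpoint cross. -/
theorem cross_of_midpoint {a b c d : Pt} (h : a + b = c + d) (hne : s(a, b) ≠ s(c, d))
    (h1 : IsEdge s(a, b)) (h2 : IsEdge s(c, d)) : Cross s(a, b) s(c, d) := by
  have cop : ∀ {a b : Pt}, IsEdge s(a, b) → IsCoprime (b.1 - a.1) (b.2 - a.2) := by
    rintro a b ⟨a', b', he, hc⟩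
    rcases Sym2.eq_iff.mp he with ⟨rfl, rfl⟩ | ⟨rfl, rfl⟩
    · exact hc
    · simpa using hc.neg_neg
  have c1 := cop h1
  have c2 := cop h2
  obtain rfl : d = a + b - c := by rw [h]; abel
  -- If the edges were collinear then `c = a + k(b - a)` and `d - c = (1 - 2k)(b - a)`; primitivity
  -- leaves `k = 0` or `k = 1`, which is the same edge.
  have hD : orient a b c ≠ 0 := by
    intro h0
    simp only [orient] at h0
    obtain ⟨m, n, hmn⟩ := c1
    obtain ⟨k, hk⟩ : ∃ k, k = m * (c.1 - a.1) + n * (c.2 - a.2) := ⟨_, rfl⟩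
    have k1 : c.1 - a.1 = k * (b.1 - a.1) := by
      rw [hk]; linear_combination (-(c.1 - a.1)) * hmn + (-n) * h0
    have k2 : c.2 - a.2 = k * (b.2 - a.2) := by
      rw [hk]; linear_combination (-(c.2 - a.2)) * hmn + m * h0
    obtain ⟨m', n', hmn'⟩ := c2
    simp only [Prod.fst_sub, Prod.fst_add, Prod.snd_sub, Prod.snd_add] at hmn'
    have hu : (1 - 2 * k) * (m' * (b.1 - a.1) + n' * (b.2 - a.2)) = 1 := by
      linear_combination hmn' + 2 * m' * k1 + 2 * n' * k2
    rcases Int.isUnit_iff.mp (IsUnit.of_mul_eq_one _ hu) with h3 | h3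
    · have : k = 0 := by omega
      apply hne
      have : c = a := by ext <;> rw [this] at k1 k2 <;> linarith
      rw [this]; exact edge_congr rfl (by abel)
    · have : k = 1 := by omega
      apply hne
      have : c = b := by ext <;> rw [this] at k1 k2 <;> linarith
      rw [this]; exact edge_congr' (by abel) rfl
  have hpos : 0 < orient a b c * orient a b c := mul_self_pos.mpr hD
  rw [cross_mk]
  constructor
  · have : orient a b (a + b - c) = -orient a b c := by simp [orient]; ring
    rw [this]; linarith
  · have e1 : orient c (a + b - c) a = -orient a b c := by simp [orient]; ring
    have e2 : orient c (a + b - c) b = orient a b c := by simp [orient]; ring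
    rw [e1, e2]; linarith

theorem IsFarey.cross_of_old_eq {f g : Flip} (hf : IsFarey f) (hg : IsFarey g)
    (h : f.old = g.old) (hne : f ≠ g) : Cross f.new g.new := by
  have hn : f.new ≠ g.new := fun h => hne (hf.ext hg h)
  obtain ⟨a, s, t, ha, rfl⟩ := hf
  obtain ⟨b, u, v, hb, rfl⟩ := hg
  have edge : ∀ {a s t : Pt}, Acute s t → IsEdge s(a, a + (s + t)) := fun h => by
    refine ⟨_, _, rfl, ?_⟩
    have := isCoprime_of_det h.1 (x := 1) (y := 1) isCoprime_one_right
    convert this using 1 <;> simp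
  refine cross_of_midpoint ?_ hn (edge ha) (edge hb)
  rcases Sym2.eq_iff.mp h with ⟨h1, h2⟩ | ⟨h1, h2⟩
  · calc a + (a + (s + t)) = (a + s) + (a + t) := by abel
      _ = b + (b + (u + v)) := by rw [h1, h2]; abel
  · calc a + (a + (s + t)) = (a + s) + (a + t) := by abel
      _ = b + (b + (u + v)) := by rw [h1, h2]; abel

/-- Emptiness: the barycentric coordinates of a lattice point are integers here, and nonnegative
integers with sum 1 single out a vertex. -/
theorem isFacet_of_orient {T : Set Edge} {a b c : Pt} (h : orient a b c = 1) (h1 : s(a, b) ∈ T)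
    (h2 : s(b, c) ∈ T) (h3 : s(c, a) ∈ T) : IsFacet T a b c := by
  refine ⟨by omega, h1, h2, h3, ?_⟩
  intro p hp
  have key : ∀ u v : Pt, 0 ≤ orient u v a → 0 ≤ orient u v b → 0 ≤ orient u v c →
      0 ≤ orient u v p := by
    intro u v ha hb hc
    have hl : ∀ q : Pt, orient u v q =
        -((v.2 - u.2) * q.1 + (u.1 - v.1) * q.2 - ((v.2 - u.2) * u.1 + (u.1 - v.1) * u.2)) :=
      fun q => by simp only [orient]; ring
    have := hull_le (α := ((v.2 - u.2 : ℤ) : ℝ)) (β := ((u.1 - v.1 : ℤ) : ℝ))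
      (γ := (((v.2 - u.2) * u.1 + (u.1 - v.1) * u.2 : ℤ) : ℝ)) ?_ hp
    · simp only [toR] at this
      have h0 : (v.2 - u.2) * p.1 + (u.1 - v.1) * p.2 ≤
        (v.2 - u.2) * u.1 + (u.1 - v.1) * u.2 := by exact_mod_cast this
      rw [hl]; linarith
    · rw [hl] at ha hb hc
      rintro q (rfl | rfl | rfl)
      · simp only [toR]; norm_cast; linarith
      · simp only [toR]; norm_cast; linarith
      · simp only [toR]; norm_cast; linarith
  have z1 : ∀ u v : Pt, orient u v u = 0 := fun u v => by simp [orient]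
  have z2 : ∀ u v : Pt, orient u v v = 0 := fun u v => by simp [orient]; ring
  have r1 : orient b c a = 1 := by rw [← h]; simp only [orient]; ring
  have r2 : orient c a b = 1 := by rw [← h]; simp only [orient]; ring
  have k1 := key a b (z1 _ _).ge (z2 _ _).ge (by omega)
  have k2 := key b c (by omega) (z1 _ _).ge (z2 _ _).ge
  have k3 := key c a (z2 _ _).ge (by omega) (z1 _ _).ge
  have hsum : orient a b p + orient b c p + orient c a p = 1 := by
    rw [← h]; simp only [orient]; ring
  have hp1 : p.1 = orient b c p * a.1 + orient c a p * b.1 + orient a b p * c.1 := by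
    simp only [orient] at h ⊢
    linear_combination (-p.1) * h
  have hp2 : p.2 = orient b c p * a.2 + orient c a p * b.2 + orient a b p * c.2 := by
    simp only [orient] at h ⊢
    linear_combination (-p.2) * h
  generalize orient a b p = x at *
  generalize orient b c p = y at *
  generalize orient c a p = z at *
  have : (y = 1 ∧ z = 0 ∧ x = 0) ∨ (y = 0 ∧ z = 1 ∧ x = 0) ∨ (y = 0 ∧ z = 0 ∧ x = 1) := by omega
  rcases this with ⟨rfl, rfl, rfl⟩ | ⟨rfl, rfl, rfl⟩ | ⟨rfl, rfl, rfl⟩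
  · left; ext <;> simp [hp1, hp2]
  · right; left; ext <;> simp [hp1, hp2]
  · right; right; ext <;> simp [hp1, hp2]

theorem IsFarey.canFlip {T : Set Edge} {f : Flip} (hf : IsFarey f) (h0 : f.old ∈ T)
    (h1 : ∀ k, SideOf k f.new → k ∈ T) : CanFlip T f := by
  have : ∃ a s t : Pt, Acute s t ∧ det s t = 1 ∧ f = ⟨s(a + s, a + t), s(a, a + (s + t))⟩ := by
    obtain ⟨a, s, t, h, rfl⟩ := hf
    have hd : (det s t - 1) * (det s t + 1) = 0 := by have := h.1; linarith
    rcases mul_eq_zero.mp hd with hd | hd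
    · exact ⟨a, s, t, h, by omega, rfl⟩
    · refine ⟨a, t, s, h.symm, ?_, ?_⟩
      · have : det t s = - det s t := by simp only [det]; ring
        omega
      · ext1
        · exact Sym2.eq_swap
        · rw [add_comm s t]
  obtain ⟨a, s, t, h, hd, rfl⟩ := this
  have m := fun k => (h1 k) ∘ (h.sideOf_iff k).mpr
  have m1 := m _ (Or.inl rfl)
  have m2 := m _ (Or.inr (Or.inl rfl))
  have m3 := m _ (Or.inr (Or.inr (Or.inl rfl)))
  have m4 := m _ (Or.inr (Or.inr (Or.inr rfl)))
  simp only [det] at hd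
  have o1 : orient (a + s) (a + (s + t)) (a + t) = 1 := by
    rw [← hd]; simp [orient]; ring
  have o2 : orient (a + (s + t)) (a + t) a = 1 := by rw [← hd]; simp [orient]; ring
  have o3 : orient (a + t) a (a + s) = 1 := by rw [← hd]; simp [orient]; ring
  have o4 : orient a (a + s) (a + (s + t)) = 1 := by rw [← hd]; simp [orient]; ring
  have o5 : orient (a + s) (a + t) a = 1 := by rw [← hd]; simp [orient]; ring
  refine ⟨a + s, a + (s + t), a + t, a, rfl, Sym2.eq_swap, by omega, by omega, by omega, by omega,
    isFacet_of_orient o1 ?_ ?_ ?_, isFacet_of_orient o5 h0 ?_ m1⟩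
  · rwa [← add_assoc]
  · rw [Sym2.eq_swap, add_comm s t, ← add_assoc]; exact m4
  · rw [Sym2.eq_swap]; exact h0
  · rw [Sym2.eq_swap]; exact m2

/-! ### Linear orderings -/

theorem FlipPoset.IsPoset.exists_linearOrdering_of_extends {π : FlipPoset} (h : π.IsPoset)
    (s : Flip → Flip → Prop) [hs : IsLinearOrder Flip s] (hle : ∀ f g, π.le f g → s f g) :
    ∃ l, π.IsLinearOrdering l ∧ l.Pairwise s := by
  classical
  have hp := h.finite.toFinset.pairwise_sort s
  have hn := h.finite.toFinset.sort_nodup s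
  refine ⟨h.finite.toFinset.sort s, ⟨⟨hn, fun f => by simp⟩, ?_⟩, hp⟩
  refine (hp.and hn).imp ?_
  rintro a b ⟨h1, h2⟩ h3
  exact h2 (Std.Antisymm.antisymm (r := s) _ _ h1 (hle _ _ h3))

/-- The quantifier over `R` expresses that `g` is listed before `f`. -/
theorem FlipPoset.IsPoset.exists_linearOrdering_of_not_le {π : FlipPoset} (h : π.IsPoset)
    {f g : Flip} (hf : f ∈ π.flips) (hg : g ∈ π.flips) (hfg : ¬ π.le f g) :
    ∃ l, π.IsLinearOrdering l ∧ ∀ R : Flip → Flip → Prop, l.Pairwise R → R g f := by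
  let le : Flip → Flip → Prop := fun x y => x = y ∨ π.le x y
  have le_refl : ∀ x, le x x := fun x => Or.inl rfl
  have le_trans : ∀ {x y z}, le x y → le y z → le x z := by
    rintro x y z (rfl | h1) (rfl | h2)
    · exact Or.inl rfl
    · exact Or.inr h2
    · exact Or.inr h1
    · exact Or.inr (h.trans _ _ _ h1 h2)
  have le_antisymm : ∀ {x y}, le x y → le y x → x = y := by
    rintro x y (rfl | h1) (h2 | h2)
    · rfl
    · rfl
    · exact h2.symm
    · exact h.antisymm _ _ h1 h2
  have hne : f ≠ g := by rintro rfl; exact hfg (h.refl f hf)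
  have hnle : ¬ le f g := by rintro (h0 | h0); exacts [hne h0, hfg h0]
  -- The partial order generated by adjoining `g ≤ f`, which is then extended to a linear order.
  let r : Flip → Flip → Prop := fun x y => le x y ∨ (le x g ∧ le f y)
  have : IsPartialOrder Flip r :=
    { refl := fun x => Or.inl (le_refl x)
      trans := by
        rintro x y z (h1 | ⟨h1, h2⟩) (h3 | ⟨h3, h4⟩)
        · exact Or.inl (le_trans h1 h3)
        · exact Or.inr ⟨le_trans h1 h3, h4⟩
        · exact Or.inr ⟨h1, le_trans h2 h3⟩
        · exact absurd (le_trans h2 h3) hnle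
      antisymm := by
        rintro x y (h1 | ⟨h1, h2⟩) (h3 | ⟨h3, h4⟩)
        · exact le_antisymm h1 h3
        · exact absurd (le_trans h4 (le_trans h1 h3)) hnle
        · exact absurd (le_trans h2 (le_trans h3 h1)) hnle
        · exact absurd (le_trans h2 h3) hnle }
  obtain ⟨s, hs, hrs⟩ := extend_partialOrder r
  obtain ⟨l, hl, hsort⟩ := h.exists_linearOrdering_of_extends s
    fun x y hxy => hrs _ _ (Or.inl (Or.inr hxy))
  refine ⟨l, hl, fun R hR => ?_⟩
  have : Std.Symm fun x y => x = y ∨ (s x y ∧ R x y) ∨ (s y x ∧ R y x) :=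
    ⟨by rintro x y (rfl | h | h); exacts [Or.inl rfl, Or.inr (Or.inr h), Or.inr (Or.inl h)]⟩
  have key := List.Pairwise.forall_of_forall
    (R := fun x y => x = y ∨ (s x y ∧ R x y) ∨ (s y x ∧ R y x)) (l := l)
    (fun x _ => Or.inl rfl) ((hsort.and hR).imp fun h => Or.inr (Or.inl h))
    ((hl.1.2 g).mpr hg) ((hl.1.2 f).mpr hf)
  have hgf : s g f := hrs _ _ (Or.inr ⟨le_refl g, le_refl f⟩)
  rcases key with h0 | h0 | h0
  · exact absurd h0.symm hne
  · exact h0.2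
  · exact absurd (Std.Antisymm.antisymm (r := s) _ _ h0.1 hgf) hne

theorem FlipPoset.IsPoset.exists_linearOrdering {π : FlipPoset} (h : π.IsPoset) :
    ∃ l, π.IsLinearOrdering l := by
  by_cases hs : ∃ f ∈ π.flips, ∃ g ∈ π.flips, ¬ π.le f g
  · obtain ⟨f, hf, g, hg, hfg⟩ := hs
    obtain ⟨l, hl, -⟩ := h.exists_linearOrdering_of_not_le hf hg hfg
    exact ⟨l, hl⟩
  · push Not at hs
    rcases Set.eq_empty_or_nonempty π.flips with he | ⟨f, hf⟩
    · exact ⟨[], ⟨⟨by simp, by simp [he]⟩, by simp⟩⟩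
    · refine ⟨[f], ⟨⟨by simp, fun g => ?_⟩, by simp⟩⟩
      rw [List.mem_singleton]
      exact ⟨fun h => h ▸ hf, fun hg => h.antisymm _ _ (hs g hg f hf) (hs f hf g hg)⟩

/-! ### Validity of the plan -/

section

variable {T G : Set Edge}

/-- By `Anc.exists_triangle` the unit edge belongs to a unit triangle that a member of `G` passes
through. -/
theorem Admissible.mem_of_anc (h : Admissible T G) {f : Flip} (hf : f ∈ below G) {k : Edge}
    (hk : Anc k f.new) (h1 : edgeLen k = 1) : k ∈ T := by
  obtain ⟨hF, e, he, ha⟩ := hf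
  have hne : edgeLen e ≠ 1 := by have := ha.le; have := hF.one_lt; omega
  obtain ⟨a, s, t, hst, hs, ht, rfl, hc⟩ := (hk.trans ha).exists_triangle h1 (h.isEdge e he) hne
  exact (h.mem_of_cross e he a s t hst hs ht hc).1

theorem Admissible.old_mem (h : Admissible T G) {f : Flip} (hf : f ∈ below G)
    (h1 : edgeLen f.old = 1) : f.old ∈ T := by
  rcases hf.1.old_anc_or with h2 | ⟨a, s, t, hst, hs, ht, h2⟩
  · exact h.mem_of_anc hf h2 h1
  · obtain ⟨hF, e, he, ha⟩ := hf
    rcases ha.cross hF.isEdge_old hF.cross.symm with h3 | h3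
    · subst h2
      exact (h.mem_of_cross e he a s t hst hs ht h3).2
    · have := h3.le; have := hF.old_lt; omega

theorem Admissible.comparable (h : Admissible T G) {f g : Flip} (hf : f ∈ below G)
    (hg : g ∈ below G) (hc : Cross f.new g.new) : Anc f.new g.new ∨ Anc g.new f.new := by
  obtain ⟨-, e, he, ha⟩ := hf
  obtain ⟨-, e', he', ha'⟩ := hg
  exact ha.comparable ha' (h.isEdge e he) (h.isEdge e' he') (h.not_cross e he e' he') hc

/-- A flip that removes a side of the parallelogram of `g` is above `g`. -/
theorem Admissible.anc_of_old_sideOf (h : Admissible T G) {f g : Flip} (hf : f ∈ below G)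
    (hg : g ∈ below G) (hs : SideOf f.old g.new) : Anc g.new f.new := by
  have hfE : IsEdge f.new := by
    obtain ⟨-, e, he, ha⟩ := hf
    exact ha.isEdge (h.isEdge e he)
  rcases hs.cross hfE hf.1.cross with h1 | h1
  · rcases h.comparable hf hg h1 with h2 | h2
    · rcases h2.cross hs.isEdge hf.1.cross.symm with h3 | h3
      · exact absurd h3.symm hs.not_cross
      · have := h3.le; have := hf.1.old_lt; omega
    · exact h2
  · exact h1

/-- Two flips of the plan that remove the same edge are equal. -/
theorem Admissible.eq_of_old_eq (h : Admissible T G) {f g : Flip} (hf : f ∈ below G)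
    (hg : g ∈ below G) (ho : f.old = g.old) : f = g := by
  have main : ∀ {f g : Flip}, f ∈ below G → g ∈ below G → f.old = g.old → f ≠ g →
      ¬ Anc f.new g.new := by
    intro f g hf hg ho hne ha
    rcases ha.eq_or_side with h1 | ⟨k, hk, hs⟩
    · exact hne (hf.1.ext hg.1 h1)
    · rcases hk.cross hg.1.isEdge_old (ho ▸ hf.1.cross.symm) with h2 | h2
      · exact hg.1.not_cross_old hs h2
      · have := h2.le; have := hf.1.old_lt; rw [ho] at this; omega
  by_contra hne
  rcases h.comparable hf hg (hf.1.cross_of_old_eq hg.1 ho hne) with h1 | h1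
  · exact main hf hg ho hne h1
  · exact main hg hf ho.symm (Ne.symm hne) h1

/-- The flips below `g` precede it, so its sides and old diagonal have been inserted or were present
as unit edges. None was removed: a flip removing a side lies above `g`, and only `g` removes its old
diagonal. -/
theorem Admissible.canFlip (h : Admissible T G) {l l' : List Flip} {g : Flip}
    (hl : (planOf G).IsLinearOrdering (l ++ g :: l')) : CanFlip (applyFlips T l) g := by
  obtain ⟨⟨hnd, hmem⟩, hp⟩ := hl
  have hg : g ∈ below G := (hmem g).mp (by simp)
  have hlG : ∀ f ∈ l, f ∈ below G := fun f hf => (hmem f).mp (by simp [hf])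
  obtain ⟨-, hp2, hp3⟩ := List.pairwise_append.mp hp
  have hlt : ∀ f ∈ l, ¬ Anc g.new f.new := fun f hf ha =>
    hp3 f hf g (by simp) ⟨hg, hlG f hf, ha⟩
  have hgl : g ∉ l := fun h0 => hlt g h0 .refl
  have hdone : ∀ k, Anc k g.new → k ≠ g.new → edgeLen k ≠ 1 → ∃ f ∈ l, f.new = k := by
    intro k hk hne h1
    rcases hk.unit_or_flip hne with h2 | ⟨f, hf, rfl⟩
    · exact absurd h2 h1
    · have hfG := below_of_anc hg hf hk
      refine ⟨f, ?_, rfl⟩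
      rcases List.mem_append.mp ((hmem f).mpr hfG) with h3 | h3
      · exact h3
      · rcases List.mem_cons.mp h3 with rfl | h3
        · exact absurd rfl hne
        · exact absurd ⟨hfG, hg, hk⟩ ((List.pairwise_cons.mp hp2).1 f h3)
  refine hg.1.canFlip ?_ ?_
  · refine mem_applyFlips ?_ ?_
    · by_cases h1 : edgeLen g.old = 1
      · exact Or.inl (h.old_mem hg h1)
      · refine Or.inr (hdone _ (hg.1.old_anc.resolve_left h1) ?_ h1)
        intro h0
        have := hg.1.old_lt
        rw [h0] at this; omega
    · intro f hf h0
      exact hgl (h.eq_of_old_eq (hlG f hf) hg h0 ▸ hf)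
  · intro k hk
    refine mem_applyFlips ?_ ?_
    · by_cases h1 : edgeLen k = 1
      · exact Or.inl (h.mem_of_anc hg hk.anc h1)
      · refine Or.inr (hdone _ hk.anc ?_ h1)
        rintro rfl
        exact absurd hk.lt (lt_irrefl _)
    · rintro f hf rfl
      exact hlt f hf (h.anc_of_old_sideOf (hlG f hf) hg hk)

theorem Admissible.isFlipPath (h : Admissible T G) {l : List Flip}
    (hl : (planOf G).IsLinearOrdering l) : IsFlipPath T l := by
  have main : ∀ l₂ l₁ : List Flip, (planOf G).IsLinearOrdering (l₁ ++ l₂) →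
      IsFlipPath (applyFlips T l₁) l₂ := by
    intro l₂
    induction l₂ with
    | nil => intro _ _; trivial
    | cons g l₂ ih =>
      intro l₁ hl
      refine ⟨h.canFlip hl, ?_⟩
      have := ih (l₁ ++ [g]) (by simpa using hl)
      rwa [applyFlips_append] at this
  simpa [applyFlips] using main l [] hl

theorem Admissible.generates (h : Admissible T G) {l : List Flip}
    (hl : (planOf G).IsLinearOrdering l) : Generates T G l := by
  refine ⟨h.isFlipPath hl, fun e he => mem_applyFlips ?_ ?_⟩
  · by_cases h1 : edgeLen e = 1
    · exact Or.inl (h.mem_of_unit e he h1)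
    · obtain ⟨f, hf, rfl⟩ := h.exists_flip e he h1
      exact Or.inr ⟨f, (hl.1.2 f).mpr ⟨hf, _, he, .refl⟩, rfl⟩
  -- A flip of the plan that removed a member of `G` would insert an edge crossing it, so that
  -- member would cross another one or lie above a longer edge.
  · rintro f hf rfl
    obtain ⟨hF, e', he', ha⟩ := (hl.1.2 f).mp hf
    rcases ha.cross (h.isEdge _ he) hF.cross.symm with h1 | h1
    · exact h.not_cross _ he _ he' h1
    · have := h1.le; have := hF.old_lt; omega

theorem Admissible.below_subset (h : Admissible T G) {l : List Flip} (hl : Generates T G l) :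
    ∀ f ∈ below G, f ∈ l := by
  rintro f ⟨hf, e, he, ha⟩
  exact hl.1.mem_of_anc h.unit (hl.2 he) hf ha

/-- The prefix ending with `f` generates `f.new`, so it already contains all flips below `f`; as
nothing repeats, none of them comes later. -/
theorem Admissible.isLinearOrdering (h : Admissible T G) {l : List Flip} (hl : IsFlipPath T l)
    (hc : (planOf G).ContainsExactly l) : (planOf G).IsLinearOrdering l := by
  refine ⟨hc, ?_⟩
  have main : ∀ l₂ l₁ : List Flip, l = l₁ ++ l₂ →
      l₂.Pairwise fun f g => ¬ (planOf G).le g f := by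
    intro l₂
    induction l₂ with
    | nil => intro _ _; exact .nil
    | cons f l₂ ih =>
      intro l₁ hl'
      refine List.pairwise_cons.mpr ⟨?_, ih (l₁ ++ [f]) (by simpa using hl')⟩
      rintro g hg ⟨hgG, -, ha⟩
      have hnd := hc.1
      have e1 : l = (l₁ ++ [f]) ++ l₂ := by simpa using hl'
      rw [e1] at hl hnd
      have hpath := (isFlipPath_append.mp hl).1
      have hin : f.new ∈ applyFlips T (l₁ ++ [f]) := by
        rw [applyFlips_append]; exact Or.inr rfl
      have := hpath.mem_of_anc h.unit hin hgG.1 ha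
      exact List.disjoint_of_nodup_append hnd this hg
  exact main l [] rfl

theorem Admissible.isMinFlipPath (h : Admissible T G) {l : List Flip}
    (hl : (planOf G).IsLinearOrdering l) : IsMinFlipPath T G l := by
  refine ⟨h.generates hl, fun l' hl' => ?_⟩
  exact (List.subperm_of_subset hl.1.1
    fun f hf => h.below_subset hl' f ((hl.1.2 f).mp hf)).length_le

theorem Admissible.isMinFlipPlan (h : Admissible T G) : IsMinFlipPlan T G (planOf G) :=
  ⟨⟨isPoset_planOf h.finite, fun _ => ⟨fun hl => ⟨h.generates hl, hl.1⟩,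
    fun hl => h.isLinearOrdering hl.1.1 hl.2⟩⟩, fun _ hl => h.isMinFlipPath hl⟩

/-- Posets on the same flips with the same linear orderings have the same order. -/
theorem FlipPoset.IsPoset.le_of_le {π π' : FlipPoset} (h : π.IsPoset)
    (h' : π'.IsPoset) (hf : π'.flips = π.flips)
    (hl : ∀ l, π.IsLinearOrdering l → π'.IsLinearOrdering l) {f g : Flip} (hle : π'.le f g) :
    π.le f g := by
  by_contra hn
  obtain ⟨m1, m2⟩ := h'.mem_of_le f g hle
  obtain ⟨l, hlin, hR⟩ := h.exists_linearOrdering_of_not_le (hf ▸ m1) (hf ▸ m2) hn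
  exact hR _ (hl l hlin).2 hle

theorem Admissible.isUniqueMinFlipPlan (h : Admissible T G) :
    IsUniqueMinFlipPlan T G (planOf G) := by
  refine ⟨h.isMinFlipPlan, fun π' hπ' => ?_⟩
  obtain ⟨⟨hpos', hplan'⟩, hmin'⟩ := hπ'
  obtain ⟨⟨hpos, hplan⟩, hmin⟩ := h.isMinFlipPlan
  -- A listing of `π'` contains `below G` and is no longer than a listing of it, so the two are
  -- permutations of each other.
  have hflips : π'.flips = (planOf G).flips := by
    obtain ⟨l', hl'⟩ := hpos'.exists_linearOrdering
    obtain ⟨l, hl⟩ := hpos.exists_linearOrdering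
    have hlen := (hmin' l' hl').2 l (h.generates hl)
    have hsub := List.subperm_of_subset hl.1.1 fun f hf =>
      h.below_subset ((hplan' l').mp hl').1 f ((hl.1.2 f).mp hf)
    have hperm := hsub.perm_of_length_le hlen
    ext f
    rw [← hl'.1.2 f, ← hl.1.2 f, hperm.mem_iff]
  have hlin : ∀ l, π'.IsLinearOrdering l ↔ (planOf G).IsLinearOrdering l := by
    intro l
    rw [hplan', hplan]
    simp only [FlipPoset.ContainsExactly, hflips]
  ext f g
  · rw [hflips]
  · exact ⟨hpos.le_of_le hpos' hflips fun l hl => (hlin l).mpr hl,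
      hpos'.le_of_le hpos hflips.symm fun l hl => (hlin l).mp hl⟩

end

/-! ### The algorithms compute the plans -/

theorem LongSideOf.eq_or {s t a : Pt} (h : Acute s t) (hlt : sqLen t < sqLen s) {k : Edge}
    (hk : LongSideOf k s(a, a + (s + t))) : k = s(a, a + s) ∨ k = s(a + t, a + t + s) := by
  obtain ⟨a', s', t', h', hlt', rfl, he⟩ := hk
  rcases h.edge_unique h' he.symm with ⟨rfl, rfl, rfl⟩ | ⟨rfl, rfl, rfl⟩ | ⟨rfl, rfl, rfl⟩ |
    ⟨rfl, rfl, rfl⟩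
  · exact Or.inl rfl
  · omega
  · exact Or.inr (edge_congr' (by abel) (by abel))
  · rw [sqLen_neg, sqLen_neg] at hlt'; omega

/-- The recursion of the plan needs only the two longer sides, since each shorter side is itself a
side of a longer one's parallelogram. -/
theorem Acute.anc_iff {s t a : Pt} (h : Acute s t) (hlt : sqLen t < sqLen s) {g : Edge}
    (hg : edgeLen g ≠ 1) : Anc g s(a, a + (s + t)) ↔
      g = s(a, a + (s + t)) ∨ Anc g s(a, a + s) ∨ Anc g s(a + t, a + t + s) := by
  constructor
  · intro ha
    rcases ha.eq_or_long hg with h1 | ⟨k, hk, hgk⟩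
    · exact Or.inl h1
    · rcases LongSideOf.eq_or h hlt hk with rfl | rfl
      · exact Or.inr (Or.inl hgk)
      · exact Or.inr (Or.inr hgk)
  · rintro (rfl | h1 | h1)
    · exact .refl
    · exact h1.tail ((h.sideOf_iff _).mpr (Or.inl rfl))
    · exact h1.tail ((h.sideOf_iff _).mpr (Or.inr (Or.inr (Or.inr rfl))))

theorem Acute.anc_iff_of_unit {s t a : Pt} (h : Acute s t) (hs : sqLen s = 1) (ht : sqLen t = 1)
    {f : Flip} (hf : IsFarey f) : Anc f.new s(a, a + (s + t)) ↔ f.new = s(a, a + (s + t)) := by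
  refine ⟨fun ha => ?_, anc_of_eq⟩
  rcases ha.eq_or_side with h1 | ⟨k, hk, hsk⟩
  · exact h1
  · have h1 := hk.le
    have h2 := hf.one_lt
    rcases (h.sideOf_iff k).mp hsk with rfl | rfl | rfl | rfl <;>
      (simp only [edgeLen_mk, add_sub_cancel_left] at h1; omega)

/-- In a reversed Farey plan, every fraction follows the longer one of its parents. -/
def GoodChain (φ : ℕ × ℕ → Pt) : List (ℕ × ℕ) → Prop
  | [] => True
  | f :: C => Acute (φ (C.headD (0, 1))) (φ f - φ (C.headD (0, 1))) ∧
      (C = [] ∧ sqLen (φ (0, 1)) = 1 ∧ sqLen (φ f - φ (0, 1)) = 1 ∨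
        C ≠ [] ∧ sqLen (φ f - φ (C.headD (0, 1))) < sqLen (φ (C.headD (0, 1)))) ∧ GoodChain φ C

theorem GoodChain.isFarey_rootFlip {φ : ℕ × ℕ → Pt} {f : ℕ × ℕ} {C : List (ℕ × ℕ)}
    (h : GoodChain φ (f :: C)) (v : Pt) : IsFarey (rootFlip φ f C v) :=
  ⟨v, _, _, h.1, by rw [rootFlip, add_sub_cancel]⟩

theorem GoodChain.mem_planFlips {φ : ℕ × ℕ → Pt} {C : List (ℕ × ℕ)} :
    ∀ {f : ℕ × ℕ}, GoodChain φ (f :: C) → ∀ (v : Pt) (h : Flip),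
      h ∈ planFlips φ (f :: C) v ↔ IsFarey h ∧ Anc h.new s(v, v + φ f) := by
  induction C with
  | nil =>
    intro f hC v h
    have hF := hC.isFarey_rootFlip v
    obtain ⟨hA, ⟨-, hs, ht⟩ | ⟨h0, -⟩, -⟩ := hC
    · simp only [List.headD_nil] at hA
      have key := fun h1 : IsFarey h => hA.anc_iff_of_unit (a := v) hs ht h1
      rw [add_sub_cancel] at key
      simp only [planFlips, Set.union_empty, Set.mem_singleton_iff]
      constructor
      · rintro rfl; exact ⟨hF, .refl⟩
      · rintro ⟨h1, h2⟩; exact h1.ext hF ((key h1).mp h2)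
    · exact absurd rfl h0
  | cons g C ih =>
    intro f hC v h
    have hF := hC.isFarey_rootFlip v
    obtain ⟨hA, ⟨h0, -⟩ | ⟨-, hlt⟩, hC'⟩ := hC
    · simp at h0
    · simp only [List.headD_cons] at hA hlt
      rw [planFlips]
      simp only [Set.mem_union, Set.mem_singleton_iff, List.headD_cons, ih hC']
      have key : IsFarey h → _ := fun h1 =>
        hA.anc_iff (a := v) hlt (g := h.new) (by have := h1.one_lt; omega)
      rw [add_sub_cancel] at key
      constructor
      · rintro ((rfl | ⟨h1, h2⟩) | ⟨h1, h2⟩)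
        · exact ⟨hF, .refl⟩
        · exact ⟨h1, (key h1).mpr (Or.inr (Or.inl h2))⟩
        · exact ⟨h1, (key h1).mpr (Or.inr (Or.inr h2))⟩
      · rintro ⟨h1, h2⟩
        rcases (key h1).mp h2 with h3 | h3 | h3
        · exact Or.inl (Or.inl (h1.ext hF h3))
        · exact Or.inl (Or.inr ⟨h1, h3⟩)
        · exact Or.inr ⟨h1, h3⟩

theorem GoodChain.sideOf_of_mem_planArcs {φ : ℕ × ℕ → Pt} {C : List (ℕ × ℕ)} :
    GoodChain φ C → ∀ (v : Pt) (x : Flip × Flip), x ∈ planArcs φ C v →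
      SideOf x.1.new x.2.new := by
  induction C with
  | nil => intro _ v x hx; simp [planArcs] at hx
  | cons f C ih =>
    intro hC v x hx
    match C, ih, hC, hx with
    | [], _, _, hx => simp [planArcs] at hx
    | g :: C, ih, hC, hx =>
      obtain ⟨hA, -, hC'⟩ := hC
      simp only [List.headD_cons] at hA
      rw [planArcs] at hx
      have hsd := fun k => hA.sideOf_iff (a := v) k
      rw [add_sub_cancel] at hsd
      rcases hx with ((rfl | rfl) | hx) | hx
      · exact (hsd _).mpr (Or.inl rfl)
      · exact (hsd _).mpr (Or.inr (Or.inr (Or.inr rfl)))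
      · exact ih hC' _ _ hx
      · exact ih hC' _ _ hx

theorem GoodChain.mem_planArcs {φ : ℕ × ℕ → Pt} {C : List (ℕ × ℕ)} :
    GoodChain φ C → ∀ (v : Pt) (f' g' : Flip), g' ∈ planFlips φ C v → IsFarey f' →
      LongSideOf f'.new g'.new → (f', g') ∈ planArcs φ C v := by
  induction C with
  | nil => intro _ v _ _ hx; simp [planFlips] at hx
  | cons f C ih =>
    intro hC v f' g' hg hf hl
    match C, ih, hC, hg with
    | [], _, hC, hg =>
      exfalso
      simp only [planFlips, Set.union_empty, Set.mem_singleton_iff] at hg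
      subst hg
      obtain ⟨hA, ⟨-, hs, ht⟩ | ⟨h0, -⟩, -⟩ := hC
      · simp only [List.headD_nil] at hA
        have key := (hA.anc_iff_of_unit (a := v) hs ht hf).mp
        rw [add_sub_cancel] at key
        have h1 := key hl.sideOf.anc
        have h2 := hl.sideOf.lt
        rw [h1] at h2
        exact lt_irrefl _ h2
      · exact h0 rfl
    | g :: C, ih, hC, hg =>
      obtain ⟨hA, ⟨h0, -⟩ | ⟨-, hlt⟩, hC'⟩ := hC
      · simp at h0
      · simp only [List.headD_cons] at hA hlt
        rw [planFlips] at hg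
        rw [planArcs]
        rcases hg with (rfl | hg) | hg
        · left; left
          have key := LongSideOf.eq_or hA hlt (a := v) (k := f'.new)
          rw [add_sub_cancel] at key
          rcases key hl with h1 | h1
          · left; rw [hf.ext (hC'.isFarey_rootFlip v) h1]
          · right; rw [hf.ext (hC'.isFarey_rootFlip _) h1]; rfl
        · exact Or.inl (Or.inr (ih hC' _ _ _ hg hf hl))
        · exact Or.inr (ih hC' _ _ _ hg hf hl)

/-- Arcs to longer sides generate the whole order on flips: by `Anc.eq_or_long` every proper descent
to a non-unit edge can start with a longer side. -/
theorem ofArcs_eq_planOf {G : Set Edge} {A : Set (Flip × Flip)}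
    (h1 : ∀ x ∈ A, SideOf x.1.new x.2.new)
    (h2 : ∀ f g, g ∈ below G → IsFarey f → LongSideOf f.new g.new → (f, g) ∈ A) :
    FlipPoset.ofArcs (below G) A = planOf G := by
  ext f g
  · rfl
  · refine and_congr_right fun hf => and_congr_right fun hg => ?_
    constructor
    · intro h
      clear hg
      induction h with
      | refl => exact .refl
      | tail _ hbc ih => exact ih.tail (h1 _ hbc)
    · intro h
      induction hn : (edgeLen g.new).toNat using Nat.strong_induction_on generalizing g with
      | _ n ih =>
      have hlen := hf.1.one_lt
      rcases h.eq_or_long (by omega) with h0 | ⟨k, hk, hfk⟩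
      · rw [hf.1.ext hg.1 h0]
      · have hle := hfk.le
        rcases hk.sideOf.unit_or_flip with h3 | ⟨k', hk', rfl⟩
        · omega
        · have hlt := hk.sideOf.lt
          exact (ih _ (by omega) k' (below_of_anc hg hk' hk.sideOf.anc) hfk rfl).tail
            (h2 _ _ hg hk' hk)

/-- The loop invariant: `f` has coprime positive coordinates `α`, `β` in the unimodular pair `lo`,
`hi`, whose images form an acute basis, and the last recorded fraction is the one with the longer
image. Initially nothing is recorded, both images are units and `headD` supplies `0/1`. Each step is
a Euclidean subtraction on `(α, β)`, so the bound `k` suffices. -/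
theorem goodChain_fareySteps {φ : ℕ × ℕ → Pt} (hφ : ∀ a b, φ (a + b) = φ a + φ b) {f : ℕ × ℕ} :
    ∀ (k : ℕ) (lo d hi : ℕ × ℕ) (acc : List (ℕ × ℕ)) (α β : ℕ), d = lo + hi → 1 ≤ α → 1 ≤ β →
      α ≤ k → β ≤ k → Nat.Coprime α β → f = α • lo + β • hi →
      hi.1 * lo.2 = lo.1 * hi.2 + 1 → Acute (φ lo) (φ hi) → GoodChain φ acc →
      (acc = [] ∧ lo = (0, 1) ∧ sqLen (φ lo) = 1 ∧ sqLen (φ hi) = 1 ∨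
        ∃ p C, acc = p :: C ∧ (p = lo ∧ sqLen (φ hi) < sqLen (φ lo) ∨
          p = hi ∧ sqLen (φ lo) < sqLen (φ hi))) →
      ∃ C, (fareySteps f k lo d hi).reverse ++ acc = f :: C ∧ GoodChain φ (f :: C) := by
  intro k
  induction k with
  | zero => intro _ _ _ _ α _ _ h1 _ h2; omega
  | succ k ih =>
    intro lo d hi acc α β hd hα hβ hαk hβk hcop hf hdet hA hacc hprev
    have hφd : φ d = φ lo + φ hi := by rw [hd, hφ]
    have hgood : GoodChain φ (d :: acc) := by
      rcases hprev with ⟨rfl, rfl, h1, h2⟩ | ⟨p, C, rfl, ⟨rfl, h1⟩ | ⟨rfl, h1⟩⟩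
      · refine ⟨?_, Or.inl ⟨rfl, h1, ?_⟩, trivial⟩
        · rwa [List.headD_nil, hφd, add_sub_cancel_left]
        · rwa [hφd, add_sub_cancel_left]
      · refine ⟨?_, Or.inr ⟨by simp, ?_⟩, hacc⟩
        · rwa [List.headD_cons, hφd, add_sub_cancel_left]
        · rwa [List.headD_cons, hφd, add_sub_cancel_left]
      · refine ⟨?_, Or.inr ⟨by simp, ?_⟩, hacc⟩
        · rw [List.headD_cons, hφd, add_sub_cancel_right]; exact hA.symm
        · rwa [List.headD_cons, hφd, add_sub_cancel_right]
    rw [fareySteps]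
    simp only [List.reverse_cons, List.append_assoc, List.singleton_append]
    -- By unimodularity the cross difference of `d` and `f` is exactly `α - β`.
    have hiff : d.1 * f.2 < f.1 * d.2 ↔ α < β := by
      have e : (d.1 * f.2 : ℤ) - f.1 * d.2 = α - β := by
        have hdet' : (hi.1 * lo.2 : ℤ) = lo.1 * hi.2 + 1 := by exact_mod_cast hdet
        rw [hd, hf]
        simp
        linear_combination (α - β : ℤ) * hdet'
      zify
      constructor <;> intro h <;> linarith
    by_cases hdf : d = f
    · rw [if_pos hdf]
      exact ⟨acc, by simp [hdf], hdf ▸ hgood⟩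
    · rw [if_neg hdf]
      have hne : α ≠ β := by
        rintro rfl
        rw [Nat.coprime_self] at hcop
        subst hcop
        exact hdf (by rw [hd, hf]; simp)
      by_cases hlt : α < β
      · rw [if_pos (hiff.mpr hlt)]
        obtain ⟨γ, rfl⟩ := Nat.exists_eq_add_of_lt hlt
        refine ih d (d + hi) hi (d :: acc) α (γ + 1) rfl hα (by omega) (by omega) (by omega) ?_ ?_
          ?_ ?_ hgood (Or.inr ⟨d, acc, rfl, Or.inl ⟨rfl, ?_⟩⟩)
        · rwa [add_assoc, Nat.coprime_self_add_right] at hcop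
        · rw [hf, hd, smul_add, add_assoc, add_assoc, ← add_smul]
        · rw [hd]; simp only [Prod.fst_add, Prod.snd_add]; nlinarith
        · rw [hφd]; exact hA.add_left
        · rw [hφd]; exact hA.lt_add_right
      · rw [if_neg (fun h => hlt (hiff.mp h))]
        obtain ⟨γ, rfl⟩ := Nat.exists_eq_add_of_lt (show β < α by omega)
        refine ih lo (lo + d) d (d :: acc) (γ + 1) β rfl (by omega) hβ (by omega) (by omega) ?_ ?_
          ?_ ?_ hgood (Or.inr ⟨d, acc, rfl, Or.inr ⟨rfl, ?_⟩⟩)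
        · rwa [add_assoc, Nat.coprime_self_add_left] at hcop
        · rw [hf, hd]; module
        · rw [hd]; simp only [Prod.fst_add, Prod.snd_add]; nlinarith
        · rw [hφd]; exact hA.add_right
        · rw [hφd]; exact hA.lt_add_left

namespace PlacedEdge

theorem coordVec_add (e : PlacedEdge) (i j i' j' : ℕ) :
    e.coordVec (i + i') (j + j') = e.coordVec i j + e.coordVec i' j' := by
  simp only [coordVec]; push_cast; module

theorem fareyInv_add (e : PlacedEdge) (a b : ℕ × ℕ) :
    e.fareyInv (a + b) = e.fareyInv a + e.fareyInv b := by
  simp only [fareyInv, Prod.fst_add, Prod.snd_add]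
  split_ifs <;> exact e.coordVec_add _ _ _ _

theorem fareyInv_fareyFlip (e : PlacedEdge) : e.fareyInv e.fareyFlip = e.coordVec e.x e.y := by
  simp only [fareyInv, fareyFlip]
  split_ifs <;> rfl

theorem acute_unitVec (i : Fin 6) : Acute (unitVec i) (unitVec (i + 1)) := by
  fin_cases i <;> simp [unitVec, Acute, det, ip]

theorem sqLen_unitVec (i : Fin 6) : sqLen (unitVec i) = 1 := by
  fin_cases i <;> simp [unitVec, sqLen]

theorem exists_goodChain (e : PlacedEdge) (h : ¬ (e.x = 0 ∨ e.y = 0)) :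
    ∃ C, (fareyPlan e).reverse = e.fareyFlip :: C ∧
      GoodChain e.fareyInv (e.fareyFlip :: C) := by
  rw [fareyPlan, if_neg h]
  push Not at h
  have hA := acute_unitVec e.sector
  have h1 := sqLen_unitVec e.sector
  have h2 := sqLen_unitVec (e.sector + 1)
  have hlo : e.fareyInv (0, 1) = if e.x < e.y then unitVec (e.sector + 1) else unitVec e.sector := by
    simp only [fareyInv, coordVec]; split_ifs <;> simp
  have hhi : e.fareyInv (1, 0) = if e.x < e.y then unitVec e.sector else unitVec (e.sector + 1) := by
    simp only [fareyInv, coordVec]; split_ifs <;> simp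
  -- In the pair `0/1`, `1/0` the coordinates of a fraction are its denominator and its numerator.
  -- The numerator is never the larger, so the denominator bounds both.
  have := goodChain_fareySteps e.fareyInv_add (f := e.fareyFlip) e.fareyFlip.2 (0, 1) (1, 1) (1, 0)
    [] e.fareyFlip.2 e.fareyFlip.1 rfl
    (by simp only [fareyFlip]; split_ifs <;> simp only <;> omega)
    (by simp only [fareyFlip]; split_ifs <;> simp only <;> omega) le_rfl
    (by simp only [fareyFlip]; split_ifs <;> simp only <;> omega)
    (by
      have := e.coprime
      simp only [fareyFlip]; split_ifs
      · exact this.symm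
      · exact this)
    (by ext <;> simp) (by simp)
    (by rw [hlo, hhi]; split_ifs <;> [exact hA.symm; exact hA]) trivial
    (Or.inl ⟨rfl, rfl, by rw [hlo]; split_ifs <;> assumption, by
      rw [hhi]; split_ifs <;> assumption⟩)
  simpa using this

theorem edgeLen_toEdge (e : PlacedEdge) (h : e.x = 0 ∨ e.y = 0) : edgeLen e.toEdge = 1 := by
  have hc := e.coprime
  rw [toEdge, edgeLen_mk, add_sub_cancel_left, coordVec]
  rcases h with h | h
  · rw [h, Nat.coprime_zero_left] at hc
    rw [h, hc]; simp [sqLen_unitVec]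
  · rw [h, Nat.coprime_zero_right] at hc
    rw [h, hc]; simp [sqLen_unitVec]

theorem isEdge_toEdge (e : PlacedEdge) : IsEdge e.toEdge := by
  refine ⟨_, _, rfl, ?_⟩
  have := isCoprime_of_det (acute_unitVec e.sector).1 (Nat.isCoprime_iff_coprime.mpr e.coprime)
  convert this using 1 <;> simp [coordVec]

theorem exists_flip (e : PlacedEdge) (h : edgeLen e.toEdge ≠ 1) :
    ∃ f, IsFarey f ∧ f.new = e.toEdge := by
  obtain ⟨C, -, hC⟩ := e.exists_goodChain fun h0 => h (e.edgeLen_toEdge h0)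
  exact ⟨_, hC.isFarey_rootFlip e.origin, by rw [rootFlip, fareyInv_fareyFlip]; rfl⟩

theorem flipSet_eq (e : PlacedEdge) : flipSet e = below {e.toEdge} := by
  ext f
  simp only [below, Set.mem_singleton_iff, exists_eq_left, Set.mem_ofPred_eq]
  by_cases h : e.x = 0 ∨ e.y = 0
  · have h1 := e.edgeLen_toEdge h
    simp only [flipSet, fareyPlan, if_pos h, List.reverse_nil, planFlips, Set.mem_empty_iff_false,
      false_iff]
    rintro ⟨hf, ha⟩
    have := hf.one_lt
    have := ha.le
    omega
  · obtain ⟨C, hC, hgood⟩ := e.exists_goodChain h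
    rw [flipSet, hC, hgood.mem_planFlips, fareyInv_fareyFlip]; rfl

theorem sideOf_of_mem_arcSet (e : PlacedEdge) : ∀ x ∈ arcSet e, SideOf x.1.new x.2.new := by
  by_cases h : e.x = 0 ∨ e.y = 0
  · simp [arcSet, fareyPlan, if_pos h, planArcs]
  · obtain ⟨C, hC, hgood⟩ := e.exists_goodChain h
    rw [arcSet, hC]
    exact hgood.sideOf_of_mem_planArcs e.origin

theorem mem_arcSet (e : PlacedEdge) {f g : Flip} (hg : g ∈ flipSet e) (hf : IsFarey f)
    (h : LongSideOf f.new g.new) : (f, g) ∈ arcSet e := by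
  by_cases h0 : e.x = 0 ∨ e.y = 0
  · simp [flipSet, fareyPlan, if_pos h0, planFlips] at hg
  · obtain ⟨C, hC, hgood⟩ := e.exists_goodChain h0
    rw [flipSet, hC] at hg
    rw [arcSet, hC]
    exact hgood.mem_planArcs e.origin f g hg hf h

end PlacedEdge

theorem flipPlan_eq (e : PlacedEdge) : flipPlan e = planOf {e.toEdge} := by
  rw [flipPlan, e.flipSet_eq]
  exact ofArcs_eq_planOf e.sideOf_of_mem_arcSet
    fun f g hg hf h => e.mem_arcSet (by rwa [e.flipSet_eq]) hf h

theorem mem_below_iff {G : Set Edge} {f : Flip} : f ∈ below G ↔ ∃ e ∈ G, f ∈ below {e} := by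
  simp only [below, Set.mem_singleton_iff, exists_eq_left, Set.mem_ofPred_eq]
  constructor
  · rintro ⟨h, e, he, ha⟩; exact ⟨e, he, h, ha⟩
  · rintro ⟨e, he, h, ha⟩; exact ⟨h, e, he, ha⟩

theorem multiFlipPlan_eq (E : Finset PlacedEdge) :
    multiFlipPlan E = planOf {g | ∃ e ∈ E, e.toEdge = g} := by
  have hF : (⋃ e ∈ E, flipSet e) = below {g | ∃ e ∈ E, e.toEdge = g} := by
    ext f
    rw [mem_below_iff]
    simp [PlacedEdge.flipSet_eq]
  rw [multiFlipPlan, hF]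
  refine ofArcs_eq_planOf ?_ ?_
  · intro x hx
    simp only [Set.mem_iUnion] at hx
    obtain ⟨e, -, hx⟩ := hx
    exact e.sideOf_of_mem_arcSet x hx
  · intro f g hg hf h
    rw [← hF] at hg
    simp only [Set.mem_iUnion] at hg ⊢
    obtain ⟨e, he, hg⟩ := hg
    exact ⟨e, he, e.mem_arcSet hg hf h⟩

/-! ### Sequential generation -/

theorem Admissible.mono {T G G' : Set Edge} (h : Admissible T G) (hG : G' ⊆ G) :
    Admissible T G' where
  unit := h.unit
  finite := h.finite.subset hG
  isEdge e he := h.isEdge e (hG he)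
  not_cross e he e' he' := h.not_cross e (hG he) e' (hG he')
  mem_of_unit e he := h.mem_of_unit e (hG he)
  exists_flip e he := h.exists_flip e (hG he)
  mem_of_cross e he := h.mem_of_cross e (hG he)

theorem admissible_of_equilateral {Ω : LatticePolygon} {T₀ : Set Edge}
    (hT₀ : IsEquilateralTriangulation Ω T₀) {E : Finset PlacedEdge}
    (hΩ : ∀ e ∈ E, seg e.toEdge ⊆ Ω.region)
    (hE : ∀ e ∈ E, ∀ e' ∈ E, e.toEdge ≠ e'.toEdge → NonCrossing e.toEdge e'.toEdge) :
    Admissible T₀ {g | ∃ e ∈ E, e.toEdge = g} where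
  unit _ he := hT₀.edgeLen_eq he
  finite := E.finite_toSet.image PlacedEdge.toEdge
  isEdge := by rintro _ ⟨e, -, rfl⟩; exact e.isEdge_toEdge
  not_cross := by
    rintro _ ⟨e, he, rfl⟩ _ ⟨e', he', rfl⟩
    by_cases h : e.toEdge = e'.toEdge
    · rw [h]; exact not_cross_self _
    · exact (hE e he e' he' h).not_cross e.isEdge_toEdge
  mem_of_unit := by
    rintro _ ⟨e, he, rfl⟩ h
    exact hT₀.mem_of_unit (hΩ e he) h
  exists_flip := by rintro _ ⟨e, -, rfl⟩ h; exact e.exists_flip h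
  mem_of_cross := by
    rintro _ ⟨e, he, rfl⟩ a s t hst hs ht hc
    exact hT₀.mem_of_cross (hΩ e he) hst hs ht hc

theorem FlipPoset.IsPoset.remove {π : FlipPoset} (h : π.IsPoset) (D : Set Flip) :
    (π.remove D).IsPoset where
  finite := h.finite.subset Set.sdiff_subset
  mem_of_le f g hfg :=
    ⟨⟨(h.mem_of_le f g hfg.2.2).1, hfg.1⟩, ⟨(h.mem_of_le f g hfg.2.2).2, hfg.2.1⟩⟩
  refl f hf := ⟨hf.2, hf.2, h.refl f hf.1⟩
  trans f g k hfg hgk := ⟨hfg.1, hgk.2.1, h.trans f g k hfg.2.2 hgk.2.2⟩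
  antisymm f g hfg hgf := h.antisymm f g hfg.2.2 hgf.2.2

theorem exists_sequentialOrdering (es : List PlacedEdge) :
    ∀ D : Set Flip, ∃ ls, IsSequentialOrdering D es ls := by
  induction es with
  | nil => exact fun _ => ⟨[], trivial⟩
  | cons e es ih =>
    intro D
    have hp : (flipPlan e).IsPoset := by
      rw [flipPlan_eq]; exact isPoset_planOf (Set.finite_singleton _)
    obtain ⟨l, hl⟩ := (hp.remove D).exists_linearOrdering
    obtain ⟨ls, hls⟩ := ih (D ∪ (flipPlan e).flips)
    exact ⟨l :: ls, hl, hls⟩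

theorem IsSequentialOrdering.take {es : List PlacedEdge} : ∀ {D : Set Flip}
    {ls : List (List Flip)}, IsSequentialOrdering D es ls → ∀ k : ℕ,
      IsSequentialOrdering D (es.take k) (ls.take k) := by
  induction es with
  | nil =>
    intro D ls h k
    match ls, h with
    | [], _ => simp [IsSequentialOrdering]
  | cons e es ih =>
    intro D ls h k
    match ls, h, k with
    | l :: ls, _, 0 => simp [IsSequentialOrdering]
    | l :: ls, ⟨h1, h2⟩, k + 1 => exact ⟨h1, ih h2 k⟩

/-- Each plan is a down-set: a flip below one performed in an earlier block belongs to that block's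
plan, so it cannot occur in a later block. -/
theorem IsSequentialOrdering.flatten {es : List PlacedEdge} : ∀ {D : Set Flip}
    {ls : List (List Flip)}, IsSequentialOrdering D es ls →
      ls.flatten.Nodup ∧
      (∀ f, f ∈ ls.flatten ↔ f ∈ below {g | ∃ e ∈ es, e.toEdge = g} ∧ f ∉ D) ∧
      ls.flatten.Pairwise fun f g => ¬ Anc g.new f.new := by
  induction es with
  | nil =>
    intro D ls h
    match ls, h with
    | [], _ => simp [below]
  | cons e es ih =>
    intro D ls h
    match ls, h with
    | l :: ls, ⟨⟨⟨hnd, hmem⟩, hp⟩, h2⟩ =>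
      obtain ⟨i1, i2, i3⟩ := ih h2
      rw [flipPlan_eq] at hmem hp
      simp only [flipPlan_eq] at i2
      have hmem' : ∀ f, f ∈ l ↔ f ∈ below {e.toEdge} ∧ f ∉ D := hmem
      have hnot : ∀ f ∈ ls.flatten, f ∉ below {e.toEdge} := fun f hf h0 =>
        ((i2 f).mp hf).2 (Or.inr h0)
      rw [List.flatten_cons]
      refine ⟨?_, ?_, ?_⟩
      · refine List.Nodup.append hnd i1 fun f hf hf' => hnot f hf' ((hmem' f).mp hf).1
      · intro f
        rw [List.mem_append, hmem', i2]
        have e1 : f ∈ below {g | ∃ e' ∈ e :: es, e'.toEdge = g} ↔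
            f ∈ below {e.toEdge} ∨ f ∈ below {g | ∃ e ∈ es, e.toEdge = g} := by
          rw [mem_below_iff, mem_below_iff (G := {g | ∃ e ∈ es, e.toEdge = g})]
          simp
        have e2 : f ∈ D ∪ (planOf {e.toEdge}).flips ↔ f ∈ D ∨ f ∈ below {e.toEdge} := Iff.rfl
        rw [e1, e2]
        tauto
      · rw [List.pairwise_append]
        refine ⟨?_, i3, ?_⟩
        · refine hp.imp_of_mem fun {a b} ha hb hab h0 => hab ?_
          have ha' := (hmem' a).mp ha
          have hb' := (hmem' b).mp hb
          exact ⟨hb'.2, ha'.2, hb'.1, ha'.1, h0⟩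
        · intro f hf g hg h0
          exact hnot g hg (below_of_anc ((hmem' f).mp hf).1 ((i2 g).mp hg).1.1 h0)

theorem IsSequentialOrdering.isLinearOrdering {es : List PlacedEdge} {ls : List (List Flip)}
    (h : IsSequentialOrdering ∅ es ls) :
    (planOf {g | ∃ e ∈ es, e.toEdge = g}).IsLinearOrdering ls.flatten := by
  obtain ⟨h1, h2, h3⟩ := h.flatten
  exact ⟨⟨h1, fun f => by rw [h2]; simp [planOf]⟩, h3.imp fun h0 h => h0 h.2.2⟩

end LatticeFlip

open LatticeFlip

theorem mainTheorem6 (Ω : LatticePolygon) (T₀ : Set Edge)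
    (hT₀ : IsEquilateralTriangulation Ω T₀) (E : Finset PlacedEdge)
    (hΩ : ∀ e ∈ E, seg e.toEdge ⊆ Ω.region)
    (hE : ∀ e ∈ E, ∀ e' ∈ E, e.toEdge ≠ e'.toEdge → NonCrossing e.toEdge e'.toEdge) :
    (∀ e ∈ E, IsUniqueMinFlipPlan T₀ {e.toEdge} (flipPlan e)) ∧
    IsUniqueMinFlipPlan T₀ {g | ∃ e ∈ E, e.toEdge = g} (multiFlipPlan E) ∧
    ∀ es : List PlacedEdge, es.Nodup → (∀ e, e ∈ es ↔ e ∈ E) →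
      (∃ ls, IsSequentialOrdering ∅ es ls) ∧
      ∀ ls, IsSequentialOrdering ∅ es ls →
        GeneratesSequentially T₀ es ls ∧
        IsMinFlipPath T₀ {g | ∃ e ∈ E, e.toEdge = g} ls.flatten := by
  have hA := admissible_of_equilateral hT₀ hΩ hE
  refine ⟨fun e he => ?_, ?_, fun es _ hes => ⟨exists_sequentialOrdering es ∅, fun ls hls => ?_⟩⟩
  · rw [flipPlan_eq]
    exact (hA.mono (by rintro _ rfl; exact ⟨e, he, rfl⟩)).isUniqueMinFlipPlan
  · rw [multiFlipPlan_eq]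
    exact hA.isUniqueMinFlipPlan
  · have hlin := hls.isLinearOrdering
    simp only [hes] at hlin
    have hmin := hA.isMinFlipPath hlin
    refine ⟨⟨hmin.1.1, fun k _ e he => ?_⟩, hmin⟩
    -- The first `k` blocks are a linear ordering of the plan for the first `k` edges, so they
    -- generate these edges by themselves.
    have hk := (hls.take k).isLinearOrdering
    have hAk : Admissible T₀ {g | ∃ e ∈ es.take k, e.toEdge = g} := hA.mono (by
      rintro _ ⟨e, he, rfl⟩
      exact ⟨e, (hes e).mp (List.mem_of_mem_take he), rfl⟩)
    exact (hAk.generates hk).2 ⟨e, he, rfl⟩
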